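/- Let $R$ be a commutative ring with unity, let $n\ge 2$ and $t\ge 0$, and let $\phi$ be an alternating (i.e. skew-symmetric with zero diagonal) $2n\times 2n$ matrix over $R$ of Pfaffian $1$; such a $\phi$ is invertible. For a commutative $R$-algebra $A$, regard $\phi$ as a matrix over $A$ by taking the images of its entries, and let $$\mathrm{Sp}_\phi(A)=\{\alpha\in \mathrm{GL}_{2n}(A)\mid \alpha^t\phi\alpha=\phi\}.$$ Write $$\phi=\begin{pmatrix}0&-c^t\\ c&\nu\end{pmatrix},\qquad \phi^{-1}=\begin{pmatrix}0&d^t\\ -d&\mu\end{pmatrix},\qquad c,d\in A^{2n-1},$$ and for $v\in A^{2n-1}$ put $$C_\phi(v)=\begin{pmatrix}1&0\\ v& I_{2n-1}+dv^t\nu\end{pmatrix},\qquad R_\phi(v)=\begin{pmatrix}1&v^t\\ 0& I_{2n-1}+\mu vc^t\end{pmatrix}.$$ The elementary symplectic group $\mathrm{ESp}_\phi(A)$ is the subgroup of $\mathrm{Sp}_\phi(A)$ generated by the matrices $C_\phi(v)$ and $R_\phi(v)$, $v\in A^{2n-1}$. Let $\theta=\theta(X_1,\ldots,X_t)\in \mathrm{Sp}_\phi(R[X_1,\ldots,X_t])$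 with $\theta(0,\ldots,0)=I_{2n}$. Suppose that for every maximal ideal $\mathfrak m$ of $R$ the image $\theta_{\mathfrak m}$ of $\theta$ over $R_{\mathfrak m}[X_1,\ldots,X_t]$ lies in $\mathrm{ESp}_\phi(R_{\mathfrak m}[X_1,\ldots,X_t])$. Then $\theta\in \mathrm{ESp}_\phi(R[X_1,\ldots,X_t])$. -/

import Mathlib

open Matrix

namespace AltForm

/-- An alternating (skew-symmetric with zero diagonal) square matrix. When `2` is a
non-zero-divisor the second condition follows from the first. -/
def IsAlternating {ι R : Type*} [CommRing R] (φ : Matrix ι ι R) : Prop :=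
  φᵀ = -φ ∧ ∀ i, φ i i = 0

/-- The Pfaffian of a `k × k` alternating matrix, by expansion along the first row:
`Pf φ = ∑_{j = 2}^{k} (-1)^j φ_{1 j} Pf (φ with rows and columns 1 and j deleted)`
(indices starting from `1`; below, `j = 0, …, k - 2` stands for the column of index `j + 2`).
It is `1` for the empty matrix and `0` in odd size. -/
def pfaffian {R : Type*} [CommRing R] : (k : ℕ) → Matrix (Fin k) (Fin k) R → R
  | 0, _ => 1
  | 1, _ => 0
  | k + 2, φ => ∑ j : Fin (k + 1), (-1) ^ (j : ℕ) * φ 0 j.succ *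
      pfaffian k (φ.submatrix (fun i => (j.succAbove i).succ) (fun i => (j.succAbove i).succ))

/-- The symplectic group `Sp_φ(A)`, of all `g ∈ GL_k(A)` with `gᵗ φ g = φ`. -/
def Sp {k : ℕ} {A : Type*} [CommRing A] (φ : Matrix (Fin k) (Fin k) A) :
    Subgroup (GL (Fin k) A) where
  carrier := {g | (g : Matrix (Fin k) (Fin k) A)ᵀ * φ * (g : Matrix (Fin k) (Fin k) A) = φ}
  one_mem' := by simp
  mul_mem' := by
    intro a b ha hb
    simp only [Set.mem_ofPred_eq] at ha hb ⊢
    rw [Units.val_mul, Matrix.transpose_mul]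
    calc _ = (b : Matrix (Fin k) (Fin k) A)ᵀ * ((a : Matrix (Fin k) (Fin k) A)ᵀ * φ *
          (a : Matrix (Fin k) (Fin k) A)) * (b : Matrix (Fin k) (Fin k) A) := by
            simp only [Matrix.mul_assoc]
      _ = φ := by rw [ha, hb]
  inv_mem' := by
    intro a ha
    simp only [Set.mem_ofPred_eq] at ha ⊢
    have h1 : (a : Matrix (Fin k) (Fin k) A) * ((a⁻¹ : GL (Fin k) A) : Matrix _ _ A) = 1 :=
      Units.mul_inv a
    have h2 : ((a⁻¹ : GL (Fin k) A) : Matrix (Fin k) (Fin k) A)ᵀ *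
        (a : Matrix (Fin k) (Fin k) A)ᵀ = 1 := by
      rw [← Matrix.transpose_mul, h1, Matrix.transpose_one]
    conv_lhs => rw [← ha]
    calc _ = (((a⁻¹ : GL (Fin k) A) : Matrix (Fin k) (Fin k) A)ᵀ *
          (a : Matrix (Fin k) (Fin k) A)ᵀ) * φ *
          ((a : Matrix (Fin k) (Fin k) A) * ((a⁻¹ : GL (Fin k) A) : Matrix _ _ A)) := by
            simp only [Matrix.mul_assoc]
      _ = φ := by rw [h1, h2, Matrix.one_mul, Matrix.mul_one]

section Vaserstein

variable {m : ℕ} {A : Type*} [CommRing A] (φ : Matrix (Fin (m + 1)) (Fin (m + 1)) A)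

/-- The column `c` in the block form `φ = (0, -cᵗ; c, ν)`. -/
def blockC : Fin m → A := fun i => φ i.succ 0

/-- The block `ν` in the block form `φ = (0, -cᵗ; c, ν)`. -/
def blockNu : Matrix (Fin m) (Fin m) A := φ.submatrix Fin.succ Fin.succ

/-- The column `d` in the block form `φ⁻¹ = (0, dᵗ; -d, μ)`. -/
noncomputable def blockD : Fin m → A := fun i => φ⁻¹ 0 i.succ

/-- The block `μ` in the block form `φ⁻¹ = (0, dᵗ; -d, μ)`. -/
noncomputable def blockMu : Matrix (Fin m) (Fin m) A := φ⁻¹.submatrix Fin.succ Fin.succ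

/-- `α_φ(v) = I + d vᵗ ν`. -/
noncomputable def alpha (v : Fin m → A) : Matrix (Fin m) (Fin m) A :=
  1 + vecMulVec (blockD φ) (v ᵥ* blockNu φ)

/-- `β_φ(v) = I + μ v cᵗ`. -/
noncomputable def beta (v : Fin m → A) : Matrix (Fin m) (Fin m) A :=
  1 + vecMulVec (blockMu φ *ᵥ v) (blockC φ)

/-- `C_φ(v) = (1, 0; v, α_φ(v))`. -/
noncomputable def matC (v : Fin m → A) : Matrix (Fin (m + 1)) (Fin (m + 1)) A :=
  Matrix.of (Fin.cons (Fin.cons 1 0) (fun i => Fin.cons (v i) (alpha φ v i)))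

/-- `R_φ(v) = (1, vᵗ; 0, β_φ(v))`. -/
noncomputable def matR (v : Fin m → A) : Matrix (Fin (m + 1)) (Fin (m + 1)) A :=
  Matrix.of (Fin.cons (Fin.cons 1 v) (fun i => Fin.cons 0 (beta φ v i)))

/-- The elementary symplectic group `ESp_φ(A)`: the group generated by all `C_φ(v)` and `R_φ(v)`,
for `v ∈ A ^ m`. (These are invertible, and lie in `Sp_φ(A)`, when `φ` is invertible
and alternating.) -/
noncomputable def ESp : Subgroup (GL (Fin (m + 1)) A) :=
  Subgroup.closure {g | ∃ v : Fin m → A,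
    (g : Matrix (Fin (m + 1)) (Fin (m + 1)) A) = matC φ v ∨
    (g : Matrix (Fin (m + 1)) (Fin (m + 1)) A) = matR φ v}

end Vaserstein

end AltForm

/-! The argument is Quillen patching. For one variable, the `s` in `R` such that `θ(X + sY) θ(X)⁻¹`
is elementary form an ideal; if it contains `1`, setting `X = 0` shows that `θ` is elementary. It is
contained in no maximal ideal `𝔪` by the dilation principle `IsLoc.dilation`: if `δ(Y)` is `1` at `Y
= 0` and becomes elementary over the localization at `𝔪`, then `δ(sY)` is elementary for some `s ∉
𝔪`. Several variables reduce to one by the homotopy `Xᵢ ↦ Xᵢ T` over the ring `R[X₁, …, X_t]`.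

Dilation requires clearing denominators in a word of generators. By `ESp_eq_elem` the elementary
group is generated by the transvections along a hyperbolic pair `e, f`: long ones `v ↦ v + a B(x, v)
x` and short ones `v ↦ v + B(x, v) w + B(w, v) x`, with `w` orthogonal to the pair. The subgroups
generated by transvections with parameters divisible by `s` serve as neighbourhoods of `1`. The
crux, `Frame.conjCont`, is that conjugation by a fixed elementary matrix is continuous; hence `g(tX)
g(0)⁻¹` is small, in particular free of denominators, for suitable `t`.

Continuity follows directly from commutator relations, except where a transvection along `e` meets
one along `f` whose parameter it does not annihilate. There the latter is rewritten as a product of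
more tractable ones, using a second pair `u, v` orthogonal to `e, f` with `B(u, v) ∉ 𝔪`. Such a pair
exists because `φ` modulo `𝔪` is invertible of size at least `3` (`exists_form_notMem`);
invertibility comes from the Pfaffian being `1` (`isUnit_det_of_pfaffian`). -/

namespace AltForm

/-! ### Long and short root transvections of an alternating form. -/

section Transvections

variable {ι A : Type*} [Fintype ι] [DecidableEq ι] [CommRing A] {ψ : Matrix ι ι A}

/-- The bilinear form with Gram matrix `ψ`. -/
noncomputable def form (ψ : Matrix ι ι A) : LinearMap.BilinForm A (ι → A) := Matrix.toBilin' ψ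

theorem form_apply (x y : ι → A) : form ψ x y = x ⬝ᵥ ψ *ᵥ y :=
  Matrix.toBilin'_apply' ψ x y

theorem form_single (i j : ι) : form ψ (Pi.single i 1) (Pi.single j 1) = ψ i j := by
  simp [form_apply]

/-- The terms at `(i, j)` and `(j, i)` cancel and the diagonal ones vanish, so no division by `2` is
needed. -/
theorem IsAlternating.form_self (hψ : IsAlternating ψ) (x : ι → A) : form ψ x x = 0 := by
  have key : ∑ p : ι × ι, x p.1 * (ψ p.1 p.2 * x p.2) = 0 := by
    refine Finset.sum_involution (fun p _ => p.swap) ?_ ?_ (fun _ _ => Finset.mem_univ _)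
      (fun _ _ => Prod.swap_swap _)
    · rintro ⟨i, j⟩ -
      have h : ψ j i = -ψ i j := congrFun (congrFun hψ.1 i) j
      simp only [Prod.swap, h]
      ring
    · rintro ⟨i, j⟩ - h he
      simp only [Prod.swap, Prod.mk.injEq] at he
      obtain ⟨rfl, -⟩ := he
      simp [hψ.2] at h
  rw [form_apply, ← key, Fintype.sum_prod_type]
  simp only [dotProduct, mulVec, Finset.mul_sum]

theorem IsAlternating.form_neg (hψ : IsAlternating ψ) (x y : ι → A) :
    form ψ y x = -form ψ x y := by
  have h := hψ.form_self (x + y)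
  simp only [map_add, LinearMap.add_apply, hψ.form_self] at h
  linear_combination h

theorem IsAlternating.form_swap (hψ : IsAlternating ψ) {x y : ι → A} (h : form ψ x y = 0) :
    form ψ y x = 0 := by
  rw [hψ.form_neg x y, h, neg_zero]

theorem form_mulVec_eq (x v : ι → A) : (x ᵥ* ψ) ⬝ᵥ v = form ψ x v := by
  rw [form_apply, dotProduct_mulVec]

/-- Two elements of `GL` with the same action on vectors are equal. -/
theorem gl_ext {g h : GL ι A} (H : ∀ v, g.1 *ᵥ v = h.1 *ᵥ v) : g = h :=
  Units.ext (Matrix.toLin'.injective (LinearMap.ext fun v => by simpa using H v))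

/-- The matrix of `v ↦ v + a B(x, v) x`. -/
noncomputable def longMat (ψ : Matrix ι ι A) (x : ι → A) (a : A) : Matrix ι ι A :=
  1 + vecMulVec (a • x) (x ᵥ* ψ)

theorem longMat_mulVec (x : ι → A) (a : A) (v : ι → A) :
    longMat ψ x a *ᵥ v = v + (a * form ψ x v) • x := by
  ext i
  simp only [longMat, add_mulVec, one_mulVec, vecMulVec_mulVec, form_mulVec_eq, Pi.add_apply,
    Pi.smul_apply, smul_eq_mul, MulOpposite.smul_eq_mul_unop, MulOpposite.unop_op]
  ring

theorem longMat_mul (hψ : IsAlternating ψ) (x : ι → A) (a b : A) :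
    longMat ψ x a * longMat ψ x b = longMat ψ x (a + b) := by
  refine Matrix.toLin'.injective (LinearMap.ext fun v => ?_)
  simp only [toLin'_apply, ← mulVec_mulVec, longMat_mulVec, map_add, map_smul, hψ.form_self]
  module

theorem longMat_zero (x : ι → A) : longMat ψ x 0 = 1 := by
  simp [longMat]

/-- The long root transvection `v ↦ v + a B(x, v) x`. -/
noncomputable def long (hψ : IsAlternating ψ) (x : ι → A) (a : A) : GL ι A where
  val := longMat ψ x a
  inv := longMat ψ x (-a)
  val_inv := by rw [longMat_mul hψ, add_neg_cancel, longMat_zero]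
  inv_val := by rw [longMat_mul hψ, neg_add_cancel, longMat_zero]

/-- The short root transvection, equal to `v ↦ v + B(x, v) y + B(y, v) x` if `B(x, y) = 0`. -/
noncomputable def short (hψ : IsAlternating ψ) (x y : ι → A) : GL ι A :=
  long hψ (x + y) 1 * long hψ x (-1) * long hψ y (-1)

variable (hψ : IsAlternating ψ)

theorem long_mulVec (x : ι → A) (a : A) (v : ι → A) :
    (long hψ x a).1 *ᵥ v = v + (a * form ψ x v) • x :=
  longMat_mulVec x a v

theorem short_mulVec {x y : ι → A} (h : form ψ x y = 0) (v : ι → A) :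
    (short hψ x y).1 *ᵥ v = v + form ψ x v • y + form ψ y v • x := by
  have h' := hψ.form_swap h
  simp only [short, Units.val_mul, ← mulVec_mulVec, long_mulVec, map_add, map_smul,
    LinearMap.add_apply, hψ.form_self, h, h']
  module

theorem long_add (x : ι → A) (a b : A) : long hψ x (a + b) = long hψ x a * long hψ x b :=
  Units.ext (longMat_mul hψ x a b).symm

theorem long_zero (x : ι → A) : long hψ x 0 = 1 := Units.ext (longMat_zero x)

theorem long_neg (x : ι → A) (a : A) : long hψ x (-a) = (long hψ x a)⁻¹ := by
  rw [eq_inv_iff_mul_eq_one, ← long_add, neg_add_cancel, long_zero]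

theorem long_smul (x : ι → A) (b a : A) : long hψ (b • x) a = long hψ x (b ^ 2 * a) := by
  refine gl_ext fun v => ?_
  simp only [long_mulVec, map_smul, LinearMap.smul_apply, smul_eq_mul]
  module

theorem long_neg_vec (x : ι → A) (a : A) : long hψ (-x) a = long hψ x a := by
  rw [← neg_one_smul A, long_smul]
  simp

theorem short_comm {x y : ι → A} (h : form ψ x y = 0) : short hψ x y = short hψ y x := by
  refine gl_ext fun v => ?_
  simp only [short_mulVec hψ h, short_mulVec hψ (hψ.form_swap h)]
  module

/-- The transvections fixing `x` form a Heisenberg group: `short` is additive in its second argument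
only up to the central `long` factor. Solving for that factor produces long root elements without
the factor `2` that a commutator would give. -/
theorem short_add {x y z : ι → A} (hy : form ψ x y = 0) (hz : form ψ x z = 0) :
    short hψ x (y + z) = short hψ x y * short hψ x z * long hψ x (-form ψ y z) := by
  have hy' := hψ.form_swap hy
  have hz' := hψ.form_swap hz
  have h : form ψ x (y + z) = 0 := by rw [map_add, hy, hz, add_zero]
  refine gl_ext fun v => ?_
  simp only [Units.val_mul, ← mulVec_mulVec, short_mulVec hψ h, short_mulVec hψ hy,
    short_mulVec hψ hz, long_mulVec, map_add, map_smul, LinearMap.add_apply, hψ.form_self,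
    hz, hy', hz', smul_eq_mul]
  module

theorem short_zero (x : ι → A) : short hψ x 0 = 1 := by
  refine gl_ext fun v => ?_
  rw [short_mulVec hψ (map_zero _)]
  simp

theorem short_neg {x y : ι → A} (h : form ψ x y = 0) :
    short hψ x (-y) = (short hψ x y)⁻¹ := by
  have h' : form ψ x (-y) = 0 := by rw [map_neg, h, neg_zero]
  rw [eq_inv_iff_mul_eq_one]
  have := short_add hψ h' h
  simpa [short_zero, long_zero, hψ.form_self] using this.symm

theorem short_smul_left {x y : ι → A} (h : form ψ x y = 0) (a : A) :
    short hψ (a • x) y = short hψ x (a • y) := by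
  refine gl_ext fun v => ?_
  rw [short_mulVec hψ (by simp [h]), short_mulVec hψ (by simp [h])]
  simp only [map_smul, LinearMap.smul_apply, smul_eq_mul]
  module

theorem short_smul_self (x : ι → A) (a : A) : short hψ x (a • x) = long hψ x (2 * a) := by
  refine gl_ext fun v => ?_
  rw [short_mulVec hψ (by simp [hψ.form_self])]
  simp only [long_mulVec, map_smul, LinearMap.smul_apply, smul_eq_mul]
  module

theorem long_vec_add {x y : ι → A} (h : form ψ x y = 0) (a : A) :
    long hψ (x + y) a = long hψ x a * long hψ y a * short hψ x (a • y) := by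
  have h' := hψ.form_swap h
  refine gl_ext fun v => ?_
  simp only [Units.val_mul, ← mulVec_mulVec, short_mulVec hψ (show form ψ x (a • y) = 0 by simp [h]),
    long_mulVec, map_add, map_smul, LinearMap.add_apply, LinearMap.smul_apply, hψ.form_self,
    h, h', smul_eq_mul]
  module

/-- `g` preserves the form. -/
def Isom (ψ : Matrix ι ι A) (g : GL ι A) : Prop :=
  ∀ x y, form ψ (g.1 *ᵥ x) (g.1 *ᵥ y) = form ψ x y

variable {hψ}

theorem Isom.mul {g h : GL ι A} (hg : Isom ψ g) (hh : Isom ψ h) : Isom ψ (g * h) := by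
  intro x y
  rw [Units.val_mul, ← mulVec_mulVec, ← mulVec_mulVec, hg, hh]

theorem isom_long (x : ι → A) (a : A) : Isom ψ (long hψ x a) := by
  intro y z
  simp only [long_mulVec, map_add, map_smul, LinearMap.add_apply, LinearMap.smul_apply,
    hψ.form_self, smul_eq_mul, hψ.form_neg x y]
  ring

theorem isom_short (x y : ι → A) : Isom ψ (short hψ x y) :=
  ((isom_long _ _).mul (isom_long _ _)).mul (isom_long _ _)

theorem Isom.conj_long {g : GL ι A} (hg : Isom ψ g) (x : ι → A) (a : A) :
    g * long hψ x a * g⁻¹ = long hψ (g.1 *ᵥ x) a := by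
  rw [mul_inv_eq_iff_eq_mul]
  refine gl_ext fun v => ?_
  simp only [Units.val_mul, ← mulVec_mulVec, long_mulVec, mulVec_add, mulVec_smul, hg x v]

/-- No orthogonality is needed, since `short` is by definition a product of long transvections. -/
theorem Isom.conj_short {g : GL ι A} (hg : Isom ψ g) (x y : ι → A) :
    g * short hψ x y * g⁻¹ = short hψ (g.1 *ᵥ x) (g.1 *ᵥ y) := by
  simp only [short, ← mulVec_add, ← hg.conj_long]
  group

end Transvections

/-! ### Divisibility as a topology, and small transvections orthogonal to the hyperbolic pair. -/

section Conjugation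

variable {ι A : Type*} [CommRing A]

/-- The filter of eventually (for divisibility) true properties of elements of `M`. -/
def divFilter (M : Submonoid A) : Filter A where
  sets := {S | ∃ t ∈ M, ∀ r ∈ M, t * r ∈ S}
  univ_sets := ⟨1, M.one_mem, fun _ _ => trivial⟩
  sets_of_superset := fun ⟨t, ht, h⟩ hS => ⟨t, ht, fun r hr => hS (h r hr)⟩
  inter_sets := by
    rintro S T ⟨t, ht, h⟩ ⟨t', ht', h'⟩
    refine ⟨t * t', M.mul_mem ht ht', fun r hr => ⟨?_, ?_⟩⟩
    · rw [mul_assoc]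
      exact h _ (M.mul_mem ht' hr)
    · rw [mul_comm t, mul_assoc]
      exact h' _ (M.mul_mem ht hr)

theorem eventually_divFilter {M : Submonoid A} {P : A → Prop} :
    (∀ᶠ t in divFilter M, P t) ↔ ∃ t ∈ M, ∀ r ∈ M, P (t * r) := Iff.rfl

theorem exists_of_eventually {M : Submonoid A} {P : A → Prop} (h : ∀ᶠ t in divFilter M, P t) :
    ∃ t ∈ M, P t := by
  obtain ⟨t, ht, h⟩ := eventually_divFilter.1 h
  exact ⟨t, ht, by simpa using h 1 M.one_mem⟩

theorem eventually_dvd {M : Submonoid A} {m : A} (hm : m ∈ M) :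
    ∀ᶠ t in divFilter M, ∃ r ∈ M, t = m * r := ⟨m, hm, fun r hr => ⟨r, hr, rfl⟩⟩

theorem eventually_mul {M : Submonoid A} {m : A} (hm : m ∈ M) {P : A → Prop}
    (h : ∀ᶠ t in divFilter M, P t) : ∀ᶠ t in divFilter M, ∃ r ∈ M, t = m * r ∧ P r := by
  obtain ⟨t, ht, h⟩ := eventually_divFilter.1 h
  exact ⟨m * t, M.mul_mem hm ht, fun r hr => ⟨t * r, M.mul_mem ht hr, mul_assoc _ _ _, h r hr⟩⟩

/-- The multiples of `s` in the subring `A₀`. -/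
def mult (A₀ : Subring A) (s : A) : AddSubgroup A where
  carrier := {a | ∃ b ∈ A₀, a = s * b}
  zero_mem' := ⟨0, A₀.zero_mem, by simp⟩
  add_mem' := by
    rintro _ _ ⟨b, hb, rfl⟩ ⟨c, hc, rfl⟩
    exact ⟨b + c, A₀.add_mem hb hc, by ring⟩
  neg_mem' := by
    rintro _ ⟨b, hb, rfl⟩
    exact ⟨-b, A₀.neg_mem hb, by ring⟩

/-- The vectors all of whose coordinates are in `s A₀`. -/
def vmult (ι : Type*) (A₀ : Subring A) (s : A) : AddSubgroup (ι → A) where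
  carrier := {x | ∀ i, x i ∈ mult A₀ s}
  zero_mem' := fun _ => (mult A₀ s).zero_mem
  add_mem' := fun hx hy i => (mult A₀ s).add_mem (hx i) (hy i)
  neg_mem' := fun hx i => (mult A₀ s).neg_mem (hx i)

variable {A₀ : Subring A} {s t : A}

theorem mem_mult {a : A} : a ∈ mult A₀ s ↔ ∃ b ∈ A₀, a = s * b := Iff.rfl

theorem mem_vmult {x : ι → A} : x ∈ vmult ι A₀ s ↔ ∀ i, x i ∈ mult A₀ s := Iff.rfl

theorem mem_mult_one {a : A} : a ∈ mult A₀ 1 ↔ a ∈ A₀ := by simp [mem_mult]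

theorem mem_vmult_one {x : ι → A} : x ∈ vmult ι A₀ 1 ↔ ∀ i, x i ∈ A₀ := by
  simp [mem_vmult, mem_mult_one]

theorem mul_mem_mult {a b : A} (ha : a ∈ mult A₀ s) (hb : b ∈ mult A₀ t) :
    a * b ∈ mult A₀ (s * t) := by
  obtain ⟨a, ha, rfl⟩ := ha
  obtain ⟨b, hb, rfl⟩ := hb
  exact ⟨a * b, A₀.mul_mem ha hb, by ring⟩

theorem mem_mult_of_dvd {a : A} (ht : t ∈ A₀) (h : a ∈ mult A₀ (s * t)) : a ∈ mult A₀ s := by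
  obtain ⟨b, hb, rfl⟩ := h
  exact ⟨t * b, A₀.mul_mem ht hb, by ring⟩

theorem mem_vmult_of_dvd {x : ι → A} (ht : t ∈ A₀) (h : x ∈ vmult ι A₀ (s * t)) :
    x ∈ vmult ι A₀ s := fun i => mem_mult_of_dvd ht (h i)

theorem smul_mem_vmult {a : A} {x : ι → A} (ha : a ∈ mult A₀ s) (hx : x ∈ vmult ι A₀ t) :
    a • x ∈ vmult ι A₀ (s * t) := fun i => mul_mem_mult ha (hx i)

theorem exists_of_mem_vmult_mul {x : ι → A} (hx : x ∈ vmult ι A₀ (s * t)) :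
    ∃ y ∈ vmult ι A₀ t, x = s • y := by
  choose b hb hxb using hx
  refine ⟨fun i => t * b i, fun i => ⟨b i, hb i, rfl⟩, ?_⟩
  ext i
  simp [hxb, mul_assoc]

theorem exists_of_mem_mult_mul {x : A} (hx : x ∈ mult A₀ (s * t)) :
    ∃ y ∈ mult A₀ t, x = s * y := by
  obtain ⟨b, hb, rfl⟩ := hx
  exact ⟨t * b, ⟨b, hb, rfl⟩, by ring⟩

variable [Fintype ι] [DecidableEq ι]

theorem form_mem_mult {ψ : Matrix ι ι A} (hψ : ∀ i j, ψ i j ∈ A₀) {x y : ι → A}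
    (hx : x ∈ vmult ι A₀ s) (hy : y ∈ vmult ι A₀ t) : form ψ x y ∈ mult A₀ (s * t) := by
  rw [form_apply]
  refine sum_mem fun i _ => mul_mem_mult (hx i) (sum_mem fun j _ => ?_)
  have := mul_mem_mult (mem_mult_one.2 (hψ i j)) (hy j)
  rwa [one_mul] at this

/-- The orthogonal complement of the span of `e` and `f`. -/
noncomputable def perp (ψ : Matrix ι ι A) (e f : ι → A) : Submodule A (ι → A) :=
  LinearMap.ker (form ψ e) ⊓ LinearMap.ker (form ψ f)

theorem mem_perp {ψ : Matrix ι ι A} {e f w : ι → A} :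
    w ∈ perp ψ e f ↔ form ψ e w = 0 ∧ form ψ f w = 0 := by
  simp [perp]

/-- The group generated by the transvections along `e` and `f` with parameters in `s A₀`. -/
noncomputable def elem {ψ : Matrix ι ι A} (hψ : IsAlternating ψ) (e f : ι → A) (A₀ : Subring A)
    (s : A) : Subgroup (GL ι A) :=
  Subgroup.closure {g | (∃ w ∈ vmult ι A₀ s, w ∈ perp ψ e f ∧
    (g = short hψ e w ∨ g = short hψ f w)) ∨
    ∃ a ∈ mult A₀ s, g = long hψ e a ∨ g = long hψ f a}

/-- A hyperbolic pair `(e, f)` and a pair `(u, v)` orthogonal to it, all with coordinates in a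
subring `A₀`, together with a monoid `M` of units of `A` in `A₀` which are the denominators of the
elements of `A`. -/
structure Frame {ψ : Matrix ι ι A} (hψ : IsAlternating ψ) (A₀ : Subring A) (M : Submonoid A)
    (e f u v : ι → A) : Prop where
  entry_mem : ∀ i j, ψ i j ∈ A₀
  le : ∀ m ∈ M, m ∈ A₀
  isUnit : ∀ m ∈ M, IsUnit m
  exists_mul_mem : ∀ a : A, ∃ m ∈ M, m * a ∈ A₀
  e_mem : ∀ i, e i ∈ A₀
  f_mem : ∀ i, f i ∈ A₀
  u_mem : ∀ i, u i ∈ A₀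
  v_mem : ∀ i, v i ∈ A₀
  ef : form ψ e f = 1
  u_perp : u ∈ perp ψ e f
  v_perp : v ∈ perp ψ e f
  uv : form ψ u v ∈ M

variable {ψ : Matrix ι ι A} {hψ : IsAlternating ψ} {M : Submonoid A} {e f u v : ι → A}

theorem short_e_mem {w : ι → A} (hw : w ∈ vmult ι A₀ s) (hw' : w ∈ perp ψ e f) :
    short hψ e w ∈ elem hψ e f A₀ s :=
  Subgroup.subset_closure (Or.inl ⟨w, hw, hw', Or.inl rfl⟩)

theorem short_f_mem {w : ι → A} (hw : w ∈ vmult ι A₀ s) (hw' : w ∈ perp ψ e f) :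
    short hψ f w ∈ elem hψ e f A₀ s :=
  Subgroup.subset_closure (Or.inl ⟨w, hw, hw', Or.inr rfl⟩)

theorem long_e_mem {a : A} (ha : a ∈ mult A₀ s) : long hψ e a ∈ elem hψ e f A₀ s :=
  Subgroup.subset_closure (Or.inr ⟨a, ha, Or.inl rfl⟩)

theorem long_f_mem {a : A} (ha : a ∈ mult A₀ s) : long hψ f a ∈ elem hψ e f A₀ s :=
  Subgroup.subset_closure (Or.inr ⟨a, ha, Or.inr rfl⟩)

theorem elem_le_of {s : A} {G : Subgroup (GL ι A)}
    (h1 : ∀ w ∈ vmult ι A₀ s, w ∈ perp ψ e f → short hψ e w ∈ G)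
    (h2 : ∀ w ∈ vmult ι A₀ s, w ∈ perp ψ e f → short hψ f w ∈ G)
    (h3 : ∀ a ∈ mult A₀ s, long hψ e a ∈ G) (h4 : ∀ a ∈ mult A₀ s, long hψ f a ∈ G) :
    elem hψ e f A₀ s ≤ G := by
  refine (Subgroup.closure_le _).2 ?_
  rintro g (⟨w, hw, hw', rfl | rfl⟩ | ⟨a, ha, rfl | rfl⟩)
  exacts [h1 w hw hw', h2 w hw hw', h3 a ha, h4 a ha]

theorem perp_swap : perp ψ f (-e) = perp ψ e f := by
  ext w
  simp only [mem_perp, map_neg, LinearMap.neg_apply, neg_eq_zero]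
  exact and_comm

/-- This symmetry makes it enough to study conjugation by transvections along `e`. -/
theorem elem_swap : elem hψ f (-e) A₀ s = elem hψ e f A₀ s := by
  have key : ∀ w ∈ perp ψ e f, short hψ (-e) w = short hψ e (-w) := by
    intro w hw
    rw [← neg_one_smul A e, short_smul_left hψ (mem_perp.1 hw).1, neg_one_smul]
  apply le_antisymm
  · refine elem_le_of (fun w hw hw' => ?_) (fun w hw hw' => ?_) (fun a ha => ?_) (fun a ha => ?_)
    · exact short_f_mem hw (by rwa [perp_swap] at hw')
    · rw [perp_swap] at hw'
      rw [key w hw']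
      exact short_e_mem (neg_mem hw) (neg_mem hw')
    · exact long_f_mem ha
    · rw [long_neg_vec]
      exact long_e_mem ha
  · refine elem_le_of (fun w hw hw' => ?_) (fun w hw hw' => ?_) (fun a ha => ?_) (fun a ha => ?_)
    · rw [← neg_neg w, ← key _ (neg_mem hw')]
      exact short_f_mem (neg_mem hw) (by rw [perp_swap]; exact neg_mem hw')
    · exact short_e_mem hw (by rwa [perp_swap])
    · rw [← long_neg_vec]
      exact long_f_mem ha
    · exact long_e_mem ha

namespace Frame

variable (F : Frame hψ A₀ M e f u v)
include F

theorem swap : Frame hψ A₀ M f (-e) u v where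
  entry_mem := F.entry_mem
  le := F.le
  isUnit := F.isUnit
  exists_mul_mem := F.exists_mul_mem
  e_mem := F.f_mem
  f_mem i := A₀.neg_mem (F.e_mem i)
  u_mem := F.u_mem
  v_mem := F.v_mem
  ef := by rw [map_neg, hψ.form_neg e f, F.ef, neg_neg]
  u_perp := by rw [perp_swap]; exact F.u_perp
  v_perp := by rw [perp_swap]; exact F.v_perp
  uv := F.uv

theorem rotate : Frame hψ A₀ M e f v (-u) where
  entry_mem := F.entry_mem
  le := F.le
  isUnit := F.isUnit
  exists_mul_mem := F.exists_mul_mem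
  e_mem := F.e_mem
  f_mem := F.f_mem
  u_mem := F.v_mem
  v_mem i := A₀.neg_mem (F.u_mem i)
  ef := F.ef
  u_perp := F.v_perp
  v_perp := neg_mem F.u_perp
  uv := by
    rw [map_neg, hψ.form_neg u v, neg_neg]
    exact F.uv

theorem fe : form ψ f e = -1 := by rw [hψ.form_neg e f, F.ef]

theorem vmult_anti (hs : s ∈ M) : ∀ᶠ t in divFilter M, ∀ y ∈ vmult ι A₀ t, y ∈ vmult ι A₀ s := by
  filter_upwards [eventually_dvd hs] with t ⟨r, hr, ht⟩ y hy
  exact mem_vmult_of_dvd (F.le r hr) (ht ▸ hy)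

theorem mult_anti (hs : s ∈ M) : ∀ᶠ t in divFilter M, ∀ y ∈ mult A₀ t, y ∈ mult A₀ s := by
  filter_upwards [eventually_dvd hs] with t ⟨r, hr, ht⟩ y hy
  exact mem_mult_of_dvd (F.le r hr) (ht ▸ hy)

theorem exists_smul_mem (x : ι → A) : ∃ m ∈ M, m • x ∈ vmult ι A₀ 1 := by
  choose m hm hx using fun i => F.exists_mul_mem (x i)
  refine ⟨∏ i, m i, M.prod_mem fun i _ => hm i, mem_vmult_one.2 fun i => ?_⟩
  rw [Pi.smul_apply, smul_eq_mul, ← Finset.prod_erase_mul _ _ (Finset.mem_univ i), mul_assoc]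
  exact A₀.mul_mem (A₀.prod_mem fun j _ => F.le _ (hm j)) (hx i)

theorem mul_small (a : A) (hs : s ∈ M) :
    ∀ᶠ t in divFilter M, ∀ b ∈ mult A₀ t, a * b ∈ mult A₀ s := by
  obtain ⟨m, hm, hma⟩ := F.exists_mul_mem a
  filter_upwards [eventually_dvd (M.mul_mem hm hs)] with t ⟨r, hr, ht⟩ b hb
  rw [ht, mul_assoc] at hb
  obtain ⟨c, hc, rfl⟩ := exists_of_mem_mult_mul hb
  have := mul_mem_mult (mem_mult_one.2 hma) (mem_mult_of_dvd (F.le r hr) hc)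
  rwa [one_mul, mul_comm m a, mul_assoc] at this

theorem smul_small (a : A) (hs : s ∈ M) :
    ∀ᶠ t in divFilter M, ∀ y ∈ vmult ι A₀ t, a • y ∈ vmult ι A₀ s := by
  filter_upwards [F.mul_small a hs] with t ht y hy i
  exact ht _ (hy i)

theorem smul_vec_small (x : ι → A) (hs : s ∈ M) :
    ∀ᶠ t in divFilter M, ∀ b ∈ mult A₀ t, b • x ∈ vmult ι A₀ s := by
  filter_upwards [Filter.eventually_all.2 fun i => F.mul_small (x i) hs] with t ht b hb i
  simpa [mul_comm] using ht i b hb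

theorem form_small (x : ι → A) (hs : s ∈ M) :
    ∀ᶠ t in divFilter M, ∀ y ∈ vmult ι A₀ t, form ψ x y ∈ mult A₀ s := by
  obtain ⟨m, hm, hx⟩ := F.exists_smul_mem x
  filter_upwards [eventually_dvd (M.mul_mem hm hs)] with t ⟨r, hr, ht⟩ y hy
  rw [ht, mul_assoc] at hy
  obtain ⟨c, hc, rfl⟩ := exists_of_mem_vmult_mul hy
  have := form_mem_mult F.entry_mem hx (mem_vmult_of_dvd (F.le r hr) hc)
  rwa [one_mul, map_smul, LinearMap.smul_apply, ← map_smul] at this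

theorem elem_anti (hs : s ∈ M) :
    ∀ᶠ t in divFilter M, elem hψ e f A₀ t ≤ elem hψ e f A₀ s := by
  filter_upwards [F.vmult_anti hs, F.mult_anti hs] with t h1 h2
  exact elem_le_of (fun w hw hw' => short_e_mem (h1 w hw) hw')
    (fun w hw hw' => short_f_mem (h1 w hw) hw') (fun a ha => long_e_mem (h2 a ha))
    (fun a ha => long_f_mem (h2 a ha))

theorem perp_of_smul (hs : s ∈ M) {w : ι → A} (h : s • w ∈ perp ψ e f) : w ∈ perp ψ e f := by
  obtain ⟨s, rfl⟩ := F.isUnit s hs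
  simpa [smul_smul] using (perp ψ e f).smul_mem (↑s⁻¹ : A) h

omit F in
theorem conj_mem_elem (g x : GL ι A) (hg : g ∈ elem hψ e f A₀ s) (hx : x ∈ elem hψ e f A₀ s) :
    g * x * g⁻¹ ∈ elem hψ e f A₀ s := mul_mem (mul_mem hg hx) (inv_mem hg)

/-- Conjugating `short e w` by `long f c` gives `short (e - c • f) w`; expanding this by `short_add`
isolates `long w c`. -/
theorem long_perp_mem (hs : s ∈ M) {w : ι → A} (hw : w ∈ vmult ι A₀ s) (hw' : w ∈ perp ψ e f)
    {c : A} (hc : c ∈ mult A₀ s) : long hψ w c ∈ elem hψ e f A₀ s := by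
  have he := (mem_perp.1 hw').1
  have hf := (mem_perp.1 hw').2
  have he' := hψ.form_swap he
  have hf' := hψ.form_swap hf
  have hcf : form ψ w (-(c • f)) = 0 := by simp [hf']
  have hcw : c • w ∈ vmult ι A₀ s := by
    exact mem_vmult_of_dvd (F.le s hs) (smul_mem_vmult hc hw)
  have key := short_add hψ he' hcf
  rw [map_neg, map_smul, F.ef, smul_eq_mul, mul_one, neg_neg, ← inv_mul_eq_iff_eq_mul] at key
  rw [← key]
  refine mul_mem (inv_mem (mul_mem ?_ ?_)) ?_
  · rw [short_comm hψ he']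
    exact short_e_mem hw hw'
  · rw [short_comm hψ hcf, ← neg_smul, short_smul_left hψ hf, neg_smul]
    exact short_f_mem (neg_mem hcw) (neg_mem (Submodule.smul_mem _ _ hw'))
  · have h := conj_mem_elem (long hψ f c) (short hψ e w) (long_f_mem hc) (short_e_mem hw hw')
    rw [(isom_long f c).conj_short, long_mulVec, long_mulVec, F.fe, hf, mul_zero, zero_smul,
      add_zero, mul_neg_one, neg_smul, short_comm hψ] at h
    · exact h
    · simp [he, hf]

/-- Conjugation by `short f (-w')` sends `e` to `e + w'` and fixes `w`, so it turns `short e w` into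
`short e w * short w w'`. -/
theorem short_perp_mem {w w' : ι → A} (hw : w ∈ vmult ι A₀ s) (hw' : w ∈ perp ψ e f)
    (hy : w' ∈ vmult ι A₀ s) (hy' : w' ∈ perp ψ e f) (h : form ψ w w' = 0) :
    short hψ w w' ∈ elem hψ e f A₀ s := by
  have hwe := hψ.form_swap (mem_perp.1 hw').1
  have hc := conj_mem_elem (short hψ f (-w')) (short hψ e w)
    (short_f_mem (neg_mem hy) (neg_mem hy')) (short_e_mem hw hw')
  have h0 : form ψ f (-w') = 0 := by simp [(mem_perp.1 hy').2]
  rw [(isom_short f (-w')).conj_short, short_mulVec hψ h0, short_mulVec hψ h0] at hc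
  simp only [F.fe, map_neg, LinearMap.neg_apply, hψ.form_swap (mem_perp.1 hy').1,
    hψ.form_swap h, (mem_perp.1 hw').2, neg_zero, zero_smul, add_zero, neg_smul, one_smul,
    neg_neg] at hc
  rw [short_comm hψ (by simp [(mem_perp.1 hw').1, hψ.form_swap h]), short_add hψ hwe h,
    (mem_perp.1 hy').1, neg_zero, long_zero, mul_one, short_comm hψ hwe] at hc
  exact (Subgroup.mul_mem_cancel_left _ (short_e_mem hw hw')).1 hc

/-- `long y c` is quadratic in `y`, so a factor taken out of `y` clears the denominator of the fixed
`c`. -/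
theorem long_perp_small (c : A) (hs : s ∈ M) :
    ∀ᶠ t in divFilter M, ∀ y ∈ vmult ι A₀ t, y ∈ perp ψ e f →
      long hψ y c ∈ elem hψ e f A₀ s := by
  obtain ⟨m, hm, hmc⟩ := F.exists_mul_mem c
  have hsm := M.mul_mem hs hm
  filter_upwards [eventually_dvd (M.mul_mem hsm hs)] with t ⟨r, hr, ht⟩ y hy hy'
  rw [ht, mul_assoc] at hy
  obtain ⟨y, hy1, rfl⟩ := exists_of_mem_vmult_mul hy
  rw [long_smul]
  refine F.long_perp_mem hs (mem_vmult_of_dvd (F.le r hr) hy1) (F.perp_of_smul hsm hy') ?_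
  exact ⟨s * m * (m * c), A₀.mul_mem (F.le _ hsm) hmc, by ring⟩

/-- A square factor of `c` moves into `w` and clears its denominators. -/
theorem long_fixed_small {w : ι → A} (hw : w ∈ perp ψ e f) (hs : s ∈ M) :
    ∀ᶠ t in divFilter M, ∀ c ∈ mult A₀ t, long hψ w c ∈ elem hψ e f A₀ s := by
  obtain ⟨m, hm, hmw⟩ := F.exists_smul_mem w
  have hsm := M.mul_mem hs hm
  filter_upwards [eventually_dvd (M.mul_mem (M.mul_mem hsm hsm) hs)] with t ⟨r, hr, ht⟩ c hc
  rw [ht, mul_assoc] at hc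
  obtain ⟨c, hc1, rfl⟩ := exists_of_mem_mult_mul hc
  rw [← sq, ← long_smul]
  refine F.long_perp_mem hs ?_ (Submodule.smul_mem _ _ hw) (mem_mult_of_dvd (F.le r hr) hc1)
  have := smul_mem_vmult (s := s) ⟨1, A₀.one_mem, (mul_one s).symm⟩ hmw
  rwa [mul_one, smul_smul] at this

theorem short_fixed_small {w : ι → A} (hw : w ∈ perp ψ e f) (hs : s ∈ M) :
    ∀ᶠ t in divFilter M, ∀ y ∈ vmult ι A₀ t, y ∈ perp ψ e f → form ψ w y = 0 →
      short hψ w y ∈ elem hψ e f A₀ s := by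
  obtain ⟨m, hm, hmw⟩ := F.exists_smul_mem w
  have hsm := M.mul_mem hs hm
  filter_upwards [eventually_dvd (M.mul_mem hsm hs)] with t ⟨r, hr, ht⟩ y hy hy' h
  rw [ht, mul_assoc] at hy
  obtain ⟨y, hy1, rfl⟩ := exists_of_mem_vmult_mul hy
  have hwy : form ψ w y = 0 := by
    rw [map_smul, smul_eq_mul] at h
    exact (F.isUnit _ hsm).mul_right_eq_zero.1 h
  rw [← short_smul_left hψ hwy]
  refine F.short_perp_mem ?_ (Submodule.smul_mem _ _ hw) (mem_vmult_of_dvd (F.le r hr) hy1)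
    (F.perp_of_smul hsm hy') (by simp [hwy])
  have := smul_mem_vmult (s := s) ⟨1, A₀.one_mem, (mul_one s).symm⟩ hmw
  rwa [mul_one, smul_smul] at this

end Frame

end Conjugation

/-! ### Continuity of conjugation by elementary matrices. -/

section Continuity

variable {ι A : Type*} [CommRing A] [Fintype ι] [DecidableEq ι] {A₀ : Subring A} {s : A}
  {ψ : Matrix ι ι A} {hψ : IsAlternating ψ} {M : Submonoid A} {e f u v : ι → A}

/-- The elements which `g` conjugates into `elem hψ e f A₀ s`. -/
noncomputable def conjElem (hψ : IsAlternating ψ) (e f : ι → A) (A₀ : Subring A) (g : GL ι A)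
    (s : A) : Subgroup (GL ι A) :=
  (elem hψ e f A₀ s).comap (MulAut.conj g).toMonoidHom

theorem mem_conjElem {g x : GL ι A} :
    x ∈ conjElem hψ e f A₀ g s ↔ g * x * g⁻¹ ∈ elem hψ e f A₀ s := Iff.rfl

/-- Conjugation by `g` is continuous for the group topology in which the groups
`elem hψ e f A₀ s`, `s ∈ M`, form a basis of neighbourhoods of `1`. -/
def ConjCont (hψ : IsAlternating ψ) (e f : ι → A) (A₀ : Subring A) (M : Submonoid A)
    (g : GL ι A) : Prop :=
  ∀ s ∈ M, ∀ᶠ t in divFilter M, elem hψ e f A₀ t ≤ conjElem hψ e f A₀ g s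

theorem ConjCont.one (F : Frame hψ A₀ M e f u v) : ConjCont hψ e f A₀ M 1 := by
  intro s hs
  filter_upwards [F.elem_anti hs] with t ht x hx
  simpa [mem_conjElem] using ht hx

theorem ConjCont.mul {g h : GL ι A} (hg : ConjCont hψ e f A₀ M g) (hh : ConjCont hψ e f A₀ M h) :
    ConjCont hψ e f A₀ M (g * h) := by
  intro s hs
  obtain ⟨t, ht, H⟩ := exists_of_eventually (hg s hs)
  filter_upwards [hh t ht] with r hr x hx
  have := mem_conjElem.1 (H (mem_conjElem.1 (hr hx)))
  rw [mem_conjElem]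
  convert this using 1
  group

/-! ### Conjugation relations between transvections. -/

section Relations

theorem conj_long_short {y : ι → A} (hef : form ψ e f = 1) (hy : y ∈ perp ψ e f) (a : A) :
    long hψ e a * short hψ f y * (long hψ e a)⁻¹ =
      short hψ f y * short hψ e (a • y) * long hψ y a := by
  have he := (mem_perp.1 hy).1
  have hf := (mem_perp.1 hy).2
  have he' := hψ.form_swap he
  have hf' := hψ.form_swap hf
  rw [(isom_long _ _).conj_short, long_mulVec, long_mulVec, hef, he, mul_one, mul_zero, zero_smul,
    add_zero, short_comm hψ (by simp [he, hf]), short_add hψ hf' (by simp [he']),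
    short_comm hψ hf', short_comm hψ (by simp [he'] : form ψ y (a • e) = 0),
    short_smul_left hψ he, map_smul, hψ.form_neg e f, hef]
  simp

variable {w y : ι → A}

theorem conj_short_e_e (hw : w ∈ perp ψ e f) (hy : y ∈ perp ψ e f) :
    short hψ e w * short hψ e y * (short hψ e w)⁻¹ =
      short hψ e y * long hψ e (2 * form ψ w y) := by
  have he := (mem_perp.1 hy).1
  have hw' := (mem_perp.1 hw).1
  rw [(isom_short _ _).conj_short, short_mulVec hψ hw', short_mulVec hψ hw', hψ.form_self, he,
    hψ.form_swap hw', zero_smul, zero_smul, add_zero, add_zero, add_zero,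
    short_add hψ he (by simp [hψ.form_self]), short_smul_self, map_smul, hψ.form_swap he]
  simp [long_zero]

theorem conj_short_long_e (hw : w ∈ perp ψ e f) (a : A) :
    short hψ e w * long hψ e a * (short hψ e w)⁻¹ = long hψ e a := by
  have hw' := (mem_perp.1 hw).1
  rw [(isom_short _ _).conj_long, short_mulVec hψ hw', hψ.form_self, hψ.form_swap hw']
  simp

theorem conj_short_long_f (hef : form ψ e f = 1) (hw : w ∈ perp ψ e f) (c : A) :
    short hψ e w * long hψ f c * (short hψ e w)⁻¹ =
      long hψ f c * long hψ w c * short hψ f (c • w) := by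
  have hw' := mem_perp.1 hw
  rw [(isom_short _ _).conj_long, short_mulVec hψ hw'.1, hef, hψ.form_swap hw'.2, one_smul,
    zero_smul, add_zero, long_vec_add hψ hw'.2]

theorem conj_short_short_f (hef : form ψ e f = 1) (hw : w ∈ perp ψ e f) (hy : y ∈ perp ψ e f)
    (h : form ψ w y = 0) :
    short hψ e w * short hψ f y * (short hψ e w)⁻¹ = short hψ f y * short hψ w y := by
  have hw' := mem_perp.1 hw
  have hy' := mem_perp.1 hy
  rw [(isom_short _ _).conj_short, short_mulVec hψ hw'.1, short_mulVec hψ hw'.1, hef,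
    hψ.form_swap hw'.2, h, hy'.1, one_smul, zero_smul, zero_smul, add_zero, add_zero, add_zero,
    short_comm hψ (by simp [hy'.2, h]),
    short_add hψ (hψ.form_swap hy'.2) (hψ.form_swap h), hw'.2, neg_zero, long_zero, mul_one,
    short_comm hψ hy'.2, short_comm hψ h]

theorem conj_short_long_perp (hw : w ∈ perp ψ e f) (hy : y ∈ perp ψ e f) (a : A) :
    short hψ e w * long hψ y a * (short hψ e w)⁻¹ =
      long hψ y a * long hψ e (form ψ w y ^ 2 * a) * short hψ e ((a * form ψ w y) • y) := by
  have hw' := mem_perp.1 hw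
  have hy' := mem_perp.1 hy
  have h : form ψ y (form ψ w y • e) = 0 := by simp [hψ.form_swap hy'.1]
  rw [(isom_short _ _).conj_long, short_mulVec hψ hw'.1, hy'.1, zero_smul, add_zero,
    long_vec_add hψ h, long_smul, smul_smul, ← short_smul_left hψ hy'.1,
    short_comm hψ (by simp [hψ.form_swap hy'.1])]

theorem conj_short_short_perp {z : ι → A} (hw : w ∈ perp ψ e f) (hy : y ∈ perp ψ e f)
    (hz : z ∈ perp ψ e f) (hwz : form ψ w z = 0) (hzy : form ψ z y = 0) :
    short hψ e w * short hψ z y * (short hψ e w)⁻¹ =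
      short hψ z y * short hψ e (form ψ w y • z) := by
  have hw' := mem_perp.1 hw
  have hy' := mem_perp.1 hy
  have hz' := mem_perp.1 hz
  have h : form ψ z (form ψ w y • e) = 0 := by simp [hψ.form_swap hz'.1]
  rw [(isom_short _ _).conj_short, short_mulVec hψ hw'.1, short_mulVec hψ hw'.1, hy'.1, hz'.1,
    hwz, zero_smul, zero_smul, add_zero, add_zero, add_zero,
    short_add hψ hzy h, short_comm hψ h, short_smul_left hψ hz'.1, map_smul,
    hψ.form_swap hy'.1]
  simp [long_zero]

theorem conj_long_short_f {x z : ι → A} (hx : form ψ f x = 0) (hz : form ψ f z = 0) (a : A) :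
    long hψ z a * short hψ f x * (long hψ z a)⁻¹ =
      short hψ f x * short hψ f ((a * form ψ z x) • z) *
        long hψ f (-form ψ x ((a * form ψ z x) • z)) := by
  rw [(isom_long _ _).conj_short, long_mulVec, long_mulVec, hψ.form_swap hz, mul_zero, zero_smul,
    add_zero, short_add hψ hx (by simp [hz])]

theorem conj_short_perp_short_f {x z : ι → A} (hx : form ψ f x = 0) (hz : form ψ f z = 0)
    (hy : form ψ f y = 0) (hyx : form ψ x y = 0) (hzy : form ψ z y = 0) :
    short hψ z y * short hψ f x * (short hψ z y)⁻¹ =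
      short hψ f x * short hψ f (form ψ z x • y) := by
  rw [(isom_short _ _).conj_short, short_mulVec hψ hzy, short_mulVec hψ hzy, hψ.form_swap hz,
    hψ.form_swap hy, hψ.form_swap hyx, zero_smul, zero_smul, add_zero, add_zero,
    add_zero, short_add hψ hx (by simp [hy]), map_smul, hyx]
  simp [long_zero]

end Relations

namespace Frame

variable (F : Frame hψ A₀ M e f u v)
include F

omit F in
theorem conjCont_of {g : GL ι A}
    (h1 : ∀ s ∈ M, ∀ᶠ t in divFilter M, ∀ y ∈ vmult ι A₀ t, y ∈ perp ψ e f →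
      short hψ e y ∈ conjElem hψ e f A₀ g s)
    (h2 : ∀ s ∈ M, ∀ᶠ t in divFilter M, ∀ y ∈ vmult ι A₀ t, y ∈ perp ψ e f →
      short hψ f y ∈ conjElem hψ e f A₀ g s)
    (h3 : ∀ s ∈ M, ∀ᶠ t in divFilter M, ∀ c ∈ mult A₀ t, long hψ e c ∈ conjElem hψ e f A₀ g s)
    (h4 : ∀ s ∈ M, ∀ᶠ t in divFilter M, ∀ c ∈ mult A₀ t, long hψ f c ∈ conjElem hψ e f A₀ g s) :
    ConjCont hψ e f A₀ M g := by
  intro s hs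
  filter_upwards [h1 s hs, h2 s hs, h3 s hs, h4 s hs] with t k1 k2 k3 k4
  exact elem_le_of k1 k2 k3 k4

/-- `long f (t² B(u, v) b)` is the Heisenberg defect of `short f` on the small vectors `(t * b) • u`
and `(-t) • v`. -/
theorem long_f_of_short {g : GL ι A}
    (h : ∀ s ∈ M, ∀ᶠ t in divFilter M, ∀ y ∈ vmult ι A₀ t, y ∈ perp ψ e f →
      short hψ f y ∈ conjElem hψ e f A₀ g s) (s : A) (hs : s ∈ M) :
    ∀ᶠ t in divFilter M, ∀ c ∈ mult A₀ t, long hψ f c ∈ conjElem hψ e f A₀ g s := by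
  obtain ⟨t, ht, H⟩ := exists_of_eventually (h s hs)
  filter_upwards [eventually_dvd (M.mul_mem (M.mul_mem ht ht) F.uv)] with r ⟨k, hk, hr⟩ c hc
  rw [hr] at hc
  obtain ⟨b, hb, rfl⟩ := mem_mult_of_dvd (F.le k hk) hc
  have hu := F.u_perp
  have hv := F.v_perp
  have hx : (t * b) • u ∈ vmult ι A₀ t := fun i => ⟨b * u i, A₀.mul_mem hb (F.u_mem i),
    by simp [mul_assoc]⟩
  have hy : (-t) • v ∈ vmult ι A₀ t := fun i => ⟨-v i, A₀.neg_mem (F.v_mem i), by simp⟩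
  have hx' := (perp ψ e f).smul_mem (t * b) hu
  have hy' := (perp ψ e f).smul_mem (-t) hv
  have key := short_add hψ (mem_perp.1 hx').2 (mem_perp.1 hy').2
  rw [← inv_mul_eq_iff_eq_mul] at key
  have hc : t * t * form ψ u v * b = -form ψ ((t * b) • u) ((-t) • v) := by
    simp only [map_smul, LinearMap.smul_apply, smul_eq_mul]
    ring
  rw [hc, ← key]
  exact mul_mem (inv_mem (mul_mem (H _ hx hx') (H _ hy hy')))
    (H _ (add_mem hx hy) (add_mem hx' hy'))

/-- Conjugating `long f c` directly would stay inside the `SL₂` of the pair `e, f`, with no evident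
factorization into small generators; it is therefore obtained from the short transvections along
`f`. -/
theorem conjCont_long_e (a : A) : ConjCont hψ e f A₀ M (long hψ e a) := by
  have h2 : ∀ s ∈ M, ∀ᶠ t in divFilter M, ∀ y ∈ vmult ι A₀ t, y ∈ perp ψ e f →
      short hψ f y ∈ conjElem hψ e f A₀ (long hψ e a) s := by
    intro s hs
    filter_upwards [F.vmult_anti hs, F.smul_small a hs, F.long_perp_small a hs] with
      t h1 h2 h3 y hy hy'
    rw [mem_conjElem, conj_long_short F.ef hy']
    exact mul_mem (mul_mem (short_f_mem (h1 y hy) hy')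
      (short_e_mem (h2 y hy) (Submodule.smul_mem _ _ hy'))) (h3 y hy hy')
  refine conjCont_of ?_ h2 ?_ (F.long_f_of_short h2)
  · intro s hs
    filter_upwards [F.vmult_anti hs] with t h y hy hy'
    rw [mem_conjElem, (isom_long _ _).conj_short, long_mulVec, long_mulVec, hψ.form_self,
      (mem_perp.1 hy').1, mul_zero, zero_smul, add_zero, add_zero]
    exact short_e_mem (h y hy) hy'
  · intro s hs
    filter_upwards [F.mult_anti hs] with t h c hc
    rw [mem_conjElem, (isom_long _ _).conj_long, long_mulVec, hψ.form_self, mul_zero, zero_smul,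
      add_zero]
    exact long_e_mem (h c hc)

/-- A group containing small short root transvections along `f` with parameters in the lines
through `u` and `v` and in the complement contains all small ones. -/
theorem short_f_of_decomp {K : Subgroup (GL ι A)}
    (hu : ∀ᶠ t in divFilter M, ∀ b ∈ mult A₀ t, short hψ f (b • u) ∈ K)
    (hv : ∀ᶠ t in divFilter M, ∀ b ∈ mult A₀ t, short hψ f (b • v) ∈ K)
    (hp : ∀ᶠ t in divFilter M, ∀ y ∈ vmult ι A₀ t, y ∈ perp ψ e f → y ∈ perp ψ u v →
      short hψ f y ∈ K)
    (hl : ∀ᶠ t in divFilter M, ∀ c ∈ mult A₀ t, long hψ f c ∈ K) :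
    ∀ᶠ t in divFilter M, ∀ y ∈ vmult ι A₀ t, y ∈ perp ψ e f → short hψ f y ∈ K := by
  have hM : ∀ᶠ t in divFilter M, t ∈ M := ⟨1, M.one_mem, fun r hr => by simpa using hr⟩
  -- Parameters are taken divisible by `h = B(u, v)`: the vector `h • y` splits into components
  -- along `v`, along `u`, and orthogonal to both, without dividing by `h`.
  filter_upwards [eventually_mul F.uv (hu.and (hv.and (hp.and (hl.and hM))))] with
    t ⟨r, _, ht, ku, kv, kp, kl, hr⟩ y hy hy'
  subst ht
  obtain ⟨y, hy1, rfl⟩ := exists_of_mem_vmult_mul hy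
  have hy2 := F.perp_of_smul F.uv hy'
  have U := mem_vmult_one.2 F.u_mem
  have V := mem_vmult_one.2 F.v_mem
  have bu : form ψ u y ∈ mult A₀ r := by simpa using form_mem_mult F.entry_mem U hy1
  have bv : form ψ v y ∈ mult A₀ r := by simpa using form_mem_mult F.entry_mem V hy1
  have hh : form ψ u v ∈ mult A₀ 1 := mem_mult_one.2 (F.le _ F.uv)
  set h := form ψ u v with hdef
  have hvu : form ψ v u = -h := hψ.form_neg u v
  set p : ι → A := form ψ u y • v with hpdef
  set q : ι → A := -form ψ v y • u with hqdef
  have P1 : p ∈ vmult ι A₀ r := by simpa using smul_mem_vmult bu V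
  have Q1 : q ∈ vmult ι A₀ r := mul_one r ▸ smul_mem_vmult (neg_mem bv) U
  have P2 : p ∈ perp ψ e f := Submodule.smul_mem _ _ F.v_perp
  have Q2 : q ∈ perp ψ e f := Submodule.smul_mem _ _ F.u_perp
  have Z1 : h • y - (p + q) ∈ vmult ι A₀ r :=
    sub_mem (by simpa using smul_mem_vmult hh hy1) (add_mem P1 Q1)
  have Z2 : h • y - (p + q) ∈ perp ψ e f := sub_mem hy' (add_mem P2 Q2)
  have Z3 : h • y - (p + q) ∈ perp ψ u v := by
    rw [mem_perp]
    simp only [hpdef, hqdef, map_sub, map_add, map_smul, hψ.form_self, hvu, smul_eq_mul, ← hdef]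
    constructor <;> ring
  have hz : form ψ (p + q) (h • y - (p + q)) = 0 := by
    rw [hpdef, hqdef, map_add, map_smul, map_smul]
    simp only [LinearMap.add_apply, LinearMap.smul_apply]
    rw [← hpdef, ← hqdef, (mem_perp.1 Z3).1, (mem_perp.1 Z3).2]
    simp
  have e1 : h • y = (p + q) + (h • y - (p + q)) := by abel
  rw [e1, short_add hψ (mem_perp.1 (add_mem P2 Q2)).2 (mem_perp.1 Z2).2, hz, neg_zero, long_zero,
    mul_one, short_add hψ (mem_perp.1 P2).2 (mem_perp.1 Q2).2]
  refine mul_mem (mul_mem (mul_mem (kv _ bu) (ku _ (neg_mem bv))) (kl _ (neg_mem ?_)))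
    (kp _ Z1 Z2 Z3)
  exact mem_mult_of_dvd (F.le r hr) (form_mem_mult F.entry_mem P1 Q1)

/-- The relations settle every generator except `short f y`; the bound for `long f c` is made
available to the argument for that remaining case. -/
theorem conjCont_short_of {w : ι → A} (hw : w ∈ perp ψ e f)
    (h : ∀ s ∈ M, (∀ s ∈ M, ∀ᶠ t in divFilter M, ∀ c ∈ mult A₀ t,
      long hψ f c ∈ conjElem hψ e f A₀ (short hψ e w) s) →
      ∀ᶠ t in divFilter M, ∀ y ∈ vmult ι A₀ t, y ∈ perp ψ e f →
      short hψ f y ∈ conjElem hψ e f A₀ (short hψ e w) s) :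
    ConjCont hψ e f A₀ M (short hψ e w) := by
  have h4 : ∀ s ∈ M, ∀ᶠ t in divFilter M, ∀ c ∈ mult A₀ t,
      long hψ f c ∈ conjElem hψ e f A₀ (short hψ e w) s := by
    intro s hs
    filter_upwards [F.mult_anti hs, F.long_fixed_small hw hs, F.smul_vec_small w hs] with
      t h1 h2 h3 c hc
    rw [mem_conjElem, conj_short_long_f F.ef hw]
    exact mul_mem (mul_mem (long_f_mem (h1 c hc)) (h2 c hc))
      (short_f_mem (h3 c hc) (Submodule.smul_mem _ _ hw))
  refine conjCont_of ?_ (fun s hs => h s hs h4) ?_ h4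
  · intro s hs
    filter_upwards [F.vmult_anti hs, F.form_small ((2 : A) • w) hs] with t h1 h2 y hy hy'
    rw [mem_conjElem, conj_short_e_e hw hy']
    refine mul_mem (short_e_mem (h1 y hy) hy') (long_e_mem ?_)
    simpa using h2 y hy
  · intro s hs
    filter_upwards [F.mult_anti hs] with t h c hc
    rw [mem_conjElem, conj_short_long_e hw]
    exact long_e_mem (h c hc)

theorem short_f_orthogonal {w : ι → A} (hw : w ∈ perp ψ e f) (hs : s ∈ M) :
    ∀ᶠ t in divFilter M, ∀ y ∈ vmult ι A₀ t, y ∈ perp ψ e f → form ψ w y = 0 →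
      short hψ f y ∈ conjElem hψ e f A₀ (short hψ e w) s := by
  filter_upwards [F.vmult_anti hs, F.short_fixed_small hw hs] with t h1 h2 y hy hy' h
  rw [mem_conjElem, conj_short_short_f F.ef hw hy' h]
  exact mul_mem (short_f_mem (h1 y hy) hy') (h2 y hy hy' h)

omit [Fintype ι] [DecidableEq ι] F in
theorem smul_mem_vmult_of_mem {b : A} (hb : b ∈ mult A₀ s) {x : ι → A} (hx : ∀ i, x i ∈ A₀) :
    b • x ∈ vmult ι A₀ s := by
  simpa using smul_mem_vmult hb (mem_vmult_one.2 hx)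

/-- Of the three directions for `y`, only the line through `v` is not orthogonal to `a • u`. -/
theorem conjCont_short_line (a : A) : ConjCont hψ e f A₀ M (short hψ e (a • u)) := by
  have hw : a • u ∈ perp ψ e f := Submodule.smul_mem _ _ F.u_perp
  refine F.conjCont_short_of hw fun s hs hl => ?_
  have hvu : form ψ v u = -form ψ u v := hψ.form_neg u v
  refine F.short_f_of_decomp ?_ ?_ ?_ (hl s hs)
  · filter_upwards [F.short_f_orthogonal hw hs] with t h b hb
    exact h _ (smul_mem_vmult_of_mem hb F.u_mem) (Submodule.smul_mem _ _ F.u_perp)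
      (by simp [hψ.form_self])
  · have hlong : ∀ᶠ t in divFilter M, ∀ b ∈ mult A₀ t,
        long hψ v b ∈ conjElem hψ e f A₀ (short hψ e (a • u)) s := by
      filter_upwards [F.long_fixed_small F.v_perp hs, F.mul_small (form ψ (a • u) v ^ 2) hs,
        F.smul_vec_small (form ψ (a • u) v • v) hs] with t h1 h2 h3 b hb
      rw [mem_conjElem, conj_short_long_perp hw F.v_perp]
      refine mul_mem (mul_mem (h1 b hb) (long_e_mem (h2 b hb))) (short_e_mem ?_
        (Submodule.smul_mem _ _ F.v_perp))
      rw [mul_smul]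
      exact h3 b hb
    have hshort := F.short_f_orthogonal hw hs
    obtain ⟨t, ht, H1, H2, H3⟩ := exists_of_eventually (hlong.and (hshort.and (hl s hs)))
    filter_upwards [eventually_dvd (M.mul_mem (M.mul_mem ht ht) F.uv)] with r ⟨k, hk, hr⟩ c hc
    rw [hr] at hc
    obtain ⟨b, hb, rfl⟩ := mem_mult_of_dvd (F.le k hk) hc
    have hfu : form ψ f (t • u) = 0 := by simp [(mem_perp.1 F.u_perp).2]
    -- Conjugating `short f (t • u)` by `long v (-(t * b))` produces `short f ((t² B(u, v) b) • v)`;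
    -- the other factors are all under control, `t • u` being orthogonal to `a • u`.
    have key := conj_long_short_f (hψ := hψ) hfu (mem_perp.1 F.v_perp).2 (-(t * b))
    have hc : -(t * b) * form ψ v (t • u) = t * t * form ψ u v * b := by
      rw [map_smul, hvu, smul_eq_mul]
      ring
    rw [hc, eq_comm, ← eq_mul_inv_iff_mul_eq, ← eq_inv_mul_iff_mul_eq] at key
    have ht1 : t ∈ mult A₀ t := ⟨1, A₀.one_mem, (mul_one t).symm⟩
    have htb : -(t * b) ∈ mult A₀ t := ⟨-b, A₀.neg_mem hb, by ring⟩
    have hsh := H2 _ (smul_mem_vmult_of_mem ht1 F.u_mem) (Submodule.smul_mem _ _ F.u_perp)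
      (by simp [hψ.form_self])
    have hlo := H1 _ htb
    rw [key]
    refine mul_mem (inv_mem hsh) (mul_mem (mul_mem (mul_mem hlo hsh) (inv_mem hlo))
      (inv_mem (H3 _ ⟨-(t * t * form ψ u v * form ψ u v * b), ?_, ?_⟩)))
    · have := F.le _ F.uv
      exact A₀.neg_mem (A₀.mul_mem (A₀.mul_mem (A₀.mul_mem (A₀.mul_mem (F.le t ht) (F.le t ht)) this) this)
        hb)
    · simp only [map_smul, LinearMap.smul_apply, smul_eq_mul]
      ring
  · filter_upwards [F.short_f_orthogonal hw hs] with t h y hy hy' hyp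
    exact h y hy hy' (by simp [(mem_perp.1 hyp).1])

theorem conjCont_short_perp {w : ι → A} (hw : w ∈ perp ψ e f) (hwuv : w ∈ perp ψ u v) :
    ConjCont hψ e f A₀ M (short hψ e w) := by
  have hwu := hψ.form_swap (mem_perp.1 hwuv).1
  have hwv := hψ.form_swap (mem_perp.1 hwuv).2
  have hvu : form ψ v u = -form ψ u v := hψ.form_neg u v
  refine F.conjCont_short_of hw fun s hs hl => ?_
  have hshort := F.short_f_orthogonal hw hs
  refine F.short_f_of_decomp ?_ ?_ ?_ (hl s hs)
  · filter_upwards [hshort] with t h b hb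
    exact h _ (smul_mem_vmult_of_mem hb F.u_mem) (Submodule.smul_mem _ _ F.u_perp) (by simp [hwu])
  · filter_upwards [hshort] with t h b hb
    exact h _ (smul_mem_vmult_of_mem hb F.v_mem) (Submodule.smul_mem _ _ F.v_perp) (by simp [hwv])
  · have hv : ∀ᶠ t in divFilter M, ∀ y ∈ vmult ι A₀ t, y ∈ perp ψ e f → y ∈ perp ψ u v →
        short hψ v y ∈ conjElem hψ e f A₀ (short hψ e w) s := by
      obtain ⟨r, hr, hr'⟩ := exists_of_eventually (F.smul_vec_small v hs)
      filter_upwards [F.short_fixed_small F.v_perp hs, F.form_small w hr] with t h1 h2 y hy hy' hyp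
      have hvy := (mem_perp.1 hyp).2
      rw [mem_conjElem, conj_short_short_perp hw hy' F.v_perp hwv hvy]
      exact mul_mem (h1 y hy hy' hvy)
        (short_e_mem (hr' _ (h2 y hy)) (Submodule.smul_mem _ _ F.v_perp))
    obtain ⟨t, ht, H1, H2⟩ := exists_of_eventually (hv.and hshort)
    filter_upwards [eventually_dvd (M.mul_mem (M.mul_mem ht F.uv) ht)] with r ⟨k, hk, hr⟩ y hy hy'
      hyp
    rw [hr, mul_assoc] at hy
    obtain ⟨y, hy1, rfl⟩ := exists_of_mem_vmult_mul hy
    have hth := M.mul_mem ht F.uv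
    have hy2 := F.perp_of_smul hth hy'
    have hy3 : y ∈ perp ψ u v := by
      obtain ⟨c, hc⟩ := F.isUnit _ hth
      rw [← hc] at hyp
      simpa [smul_smul] using (perp ψ u v).smul_mem (↑c⁻¹ : A) hyp
    have hfu : form ψ f (t • u) = 0 := by simp [(mem_perp.1 F.u_perp).2]
    -- `short f ((t B(u, v)) • y)` is a commutator of `short v (-y)` and `short f (t • u)`, both
    -- already known to conjugate well, whatever the value of `B(w, y)`.
    have key := conj_short_perp_short_f (hψ := hψ) (y := -y) hfu (mem_perp.1 F.v_perp).2
      (mem_perp.1 (neg_mem hy2)).2 (by simp [(mem_perp.1 hy3).1]) (mem_perp.1 (neg_mem hy3)).2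
    have hc : form ψ v (t • u) • (-y) = (t * form ψ u v) • y := by
      rw [map_smul, hvu, smul_eq_mul]
      module
    rw [hc, eq_comm, ← eq_inv_mul_iff_mul_eq] at key
    have ht1 : t ∈ mult A₀ t := ⟨1, A₀.one_mem, (mul_one t).symm⟩
    have hsh := H2 _ (smul_mem_vmult_of_mem ht1 F.u_mem) (Submodule.smul_mem _ _ F.u_perp)
      (by simp [hwu])
    have hlo := H1 _ (neg_mem (mem_vmult_of_dvd (F.le k hk) hy1)) (neg_mem hy2) (neg_mem hy3)
    rw [key]
    exact mul_mem (inv_mem hsh) (mul_mem (mul_mem hlo hsh) (inv_mem hlo))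

/-- `B(u, v)` is invertible in `A`, so `w` splits along `v`, along `-u` and orthogonally to both;
rotating the pair `(u, v)` brings each line to the case already treated. -/
theorem conjCont_short_e {w : ι → A} (hw : w ∈ perp ψ e f) :
    ConjCont hψ e f A₀ M (short hψ e w) := by
  obtain ⟨h, hh⟩ := F.isUnit _ F.uv
  have hvu : form ψ v u = -form ψ u v := hψ.form_neg u v
  have hinv : (↑h⁻¹ : A) * form ψ u v = 1 := by rw [← hh, Units.inv_mul]
  set p : ι → A := (↑h⁻¹ * form ψ u w) • v with hp
  set q : ι → A := (↑h⁻¹ * form ψ v w) • (-u) with hq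
  have P2 : p ∈ perp ψ e f := Submodule.smul_mem _ _ F.v_perp
  have Q2 : q ∈ perp ψ e f := Submodule.smul_mem _ _ (neg_mem F.u_perp)
  have Z2 : w - (p + q) ∈ perp ψ e f := sub_mem hw (add_mem P2 Q2)
  have Z3 : w - (p + q) ∈ perp ψ u v := by
    rw [mem_perp]
    simp only [hp, hq, map_sub, map_add, map_smul, map_neg, hψ.form_self, hvu, smul_eq_mul]
    constructor
    · linear_combination (-form ψ u w) * hinv
    · linear_combination (-form ψ v w) * hinv
  have e1 : w = (p + q) + (w - (p + q)) := by abel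
  rw [e1, short_add hψ (mem_perp.1 (add_mem P2 Q2)).1 (mem_perp.1 Z2).1,
    short_add hψ (mem_perp.1 P2).1 (mem_perp.1 Q2).1]
  exact (((F.rotate.conjCont_short_line _).mul (F.rotate.rotate.conjCont_short_line _)).mul
    (F.conjCont_long_e _)).mul (F.conjCont_short_perp Z2 Z3) |>.mul (F.conjCont_long_e _)

omit F in
theorem conjCont_swap {g : GL ι A} (h : ConjCont hψ f (-e) A₀ M g) : ConjCont hψ e f A₀ M g := by
  intro s hs
  simpa only [ConjCont, conjElem, elem_swap] using h s hs

/-- Conjugation by elementary matrices is continuous. -/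
theorem conjCont {g : GL ι A} (hg : g ∈ elem hψ e f ⊤ 1) : ConjCont hψ e f A₀ M g := by
  suffices h : ConjCont hψ e f A₀ M g ∧ ConjCont hψ e f A₀ M g⁻¹ from h.1
  refine Subgroup.closure_induction
    (p := fun g _ => ConjCont hψ e f A₀ M g ∧ ConjCont hψ e f A₀ M g⁻¹) ?_ ?_ ?_ ?_ hg
  · rintro g (⟨w, -, hw, rfl | rfl⟩ | ⟨a, -, rfl | rfl⟩)
    · rw [← short_neg hψ (mem_perp.1 hw).1]
      exact ⟨F.conjCont_short_e hw, F.conjCont_short_e (neg_mem hw)⟩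
    · rw [← short_neg hψ (mem_perp.1 hw).2]
      rw [← perp_swap] at hw
      exact ⟨conjCont_swap (F.swap.conjCont_short_e hw),
        conjCont_swap (F.swap.conjCont_short_e (neg_mem hw))⟩
    · rw [← long_neg]
      exact ⟨F.conjCont_long_e _, F.conjCont_long_e _⟩
    · rw [← long_neg]
      exact ⟨conjCont_swap (F.swap.conjCont_long_e _),
        conjCont_swap (F.swap.conjCont_long_e _)⟩
  · rw [inv_one]
    exact ⟨ConjCont.one F, ConjCont.one F⟩
  · intro g h _ _ hg hh
    rw [_root_.mul_inv_rev]
    exact ⟨hg.1.mul hh.1, hh.2.mul hg.2⟩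
  · intro g _ hg
    rw [inv_inv]
    exact hg.symm

end Frame

end Continuity

theorem gl_map_map {ι A A' A'' : Type*} [CommRing A] [CommRing A'] [CommRing A''] [Fintype ι]
    [DecidableEq ι] (σ : A' →+* A'') (τ : A →+* A') (g : GL ι A) :
    GeneralLinearGroup.map σ (GeneralLinearGroup.map τ g) =
      GeneralLinearGroup.map (σ.comp τ) g := rfl

/-! ### Behaviour under ring homomorphisms. -/

section Functoriality

variable {ι A A' : Type*} [CommRing A] [CommRing A'] [Fintype ι] [DecidableEq ι]
  {ψ : Matrix ι ι A} {ψ' : Matrix ι ι A'} (hψ : IsAlternating ψ) (hψ' : IsAlternating ψ')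
  (σ : A →+* A')

omit [Fintype ι] [DecidableEq ι] in
include hψ in
theorem IsAlternating.map : IsAlternating (ψ.map σ) := by
  refine ⟨?_, fun i => by simp [hψ.2 i]⟩
  rw [← transpose_map, hψ.1]
  ext i j
  simp

variable {σ} (h : ψ.map σ = ψ')
include h

theorem map_form (x y : ι → A) : σ (form ψ x y) = form ψ' (σ ∘ x) (σ ∘ y) := by
  subst h
  rw [form_apply, form_apply, RingHom.map_dotProduct]
  congr 1
  ext i
  exact RingHom.map_mulVec σ ψ y i

theorem map_long (x : ι → A) (a : A) :
    GeneralLinearGroup.map σ (long hψ x a) = long hψ' (σ ∘ x) (σ a) := by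
  subst h
  refine GeneralLinearGroup.ext fun i j => ?_
  rw [GeneralLinearGroup.map_apply]
  change σ (longMat ψ x a i j) = longMat (ψ.map σ) (σ ∘ x) (σ a) i j
  have h1 : σ ((x ᵥ* ψ) j) = ((σ ∘ x) ᵥ* ψ.map σ) j := RingHom.map_vecMul σ ψ x j
  simp only [longMat, Matrix.add_apply, vecMulVec_apply, Pi.smul_apply, smul_eq_mul, map_add,
    map_mul, Matrix.one_apply, h1, Function.comp_apply, apply_ite σ, map_one, map_zero]

theorem map_short (x y : ι → A) :
    GeneralLinearGroup.map σ (short hψ x y) = short hψ' (σ ∘ x) (σ ∘ y) := by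
  simp only [short, map_mul, map_long hψ hψ' h, map_neg, map_one]
  congr 3
  ext i
  simp

theorem map_mem_perp {e f w : ι → A} (hw : w ∈ perp ψ e f) :
    σ ∘ w ∈ perp ψ' (σ ∘ e) (σ ∘ f) := by
  rw [mem_perp] at hw ⊢
  rw [← map_form h, ← map_form h, hw.1, hw.2]
  simp

omit h in
theorem short_mem_elem_top {e f w : ι → A} (hw : w ∈ perp ψ e f) :
    short hψ e w ∈ elem hψ e f ⊤ 1 ∧ short hψ f w ∈ elem hψ e f ⊤ 1 :=
  ⟨short_e_mem (mem_vmult_one.2 fun _ => trivial) hw,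
    short_f_mem (mem_vmult_one.2 fun _ => trivial) hw⟩

omit h in
theorem long_mem_elem_top (e f : ι → A) (a : A) :
    long hψ e a ∈ elem hψ e f ⊤ 1 ∧ long hψ f a ∈ elem hψ e f ⊤ 1 :=
  ⟨long_e_mem (mem_mult_one.2 trivial), long_f_mem (mem_mult_one.2 trivial)⟩

theorem map_mem_elem {e f : ι → A} {g : GL ι A} (hg : g ∈ elem hψ e f ⊤ 1) :
    GeneralLinearGroup.map σ g ∈ elem hψ' (σ ∘ e) (σ ∘ f) ⊤ 1 := by
  suffices H : elem hψ e f ⊤ 1 ≤ (elem hψ' (σ ∘ e) (σ ∘ f) ⊤ 1).comap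
    (GeneralLinearGroup.map σ) from H hg
  refine elem_le_of (fun w _ hw => ?_) (fun w _ hw => ?_) (fun a _ => ?_) (fun a _ => ?_) <;>
    rw [Subgroup.mem_comap]
  · rw [map_short hψ hψ' h]
    exact (short_mem_elem_top hψ' (map_mem_perp h hw)).1
  · rw [map_short hψ hψ' h]
    exact (short_mem_elem_top hψ' (map_mem_perp h hw)).2
  · rw [map_long hψ hψ' h]
    exact (long_mem_elem_top hψ' _ _ _).1
  · rw [map_long hψ hψ' h]
    exact (long_mem_elem_top hψ' _ _ _).2

omit h in
/-- The projection to the orthogonal complement of a hyperbolic pair. -/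
theorem exists_perp_add {e f : ι → A} (hef : form ψ e f = 1) (hψ : IsAlternating ψ) (w : ι → A) :
    w - form ψ e w • f + form ψ f w • e ∈ perp ψ e f := by
  have hfe : form ψ f e = -1 := by rw [hψ.form_neg e f, hef]
  simp [mem_perp, hψ.form_self, hef, hfe]

/-- A coordinatewise lift of a parameter need not be orthogonal to `e, f`; projecting it to the
complement does not change its image. -/
theorem elem_range_le {e f : ι → A} (hef : form ψ e f = 1) :
    elem hψ' (σ ∘ e) (σ ∘ f) σ.range 1 ≤
      (elem hψ e f ⊤ 1).map (GeneralLinearGroup.map σ) := by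
  have lift : ∀ w ∈ vmult ι σ.range 1, w ∈ perp ψ' (σ ∘ e) (σ ∘ f) →
      ∃ x ∈ perp ψ e f, w = σ ∘ x := by
    intro w hw hw'
    rw [mem_vmult_one] at hw
    choose x hx using hw
    obtain rfl : σ ∘ x = w := funext hx
    refine ⟨_, exists_perp_add hef hψ x, ?_⟩
    rw [mem_perp, ← map_form h, ← map_form h] at hw'
    ext i
    simp [hw'.1, hw'.2]
  refine elem_le_of (fun w hw hw' => ?_) (fun w hw hw' => ?_) (fun a ha => ?_) (fun a ha => ?_)
  · obtain ⟨x, hx, rfl⟩ := lift w hw hw'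
    exact ⟨_, (short_mem_elem_top hψ hx).1, map_short hψ hψ' h _ _⟩
  · obtain ⟨x, hx, rfl⟩ := lift w hw hw'
    exact ⟨_, (short_mem_elem_top hψ hx).2, map_short hψ hψ' h _ _⟩
  · obtain ⟨x, rfl⟩ := mem_mult_one.1 ha
    exact ⟨_, (long_mem_elem_top hψ _ _ _).1, map_long hψ hψ' h _ _⟩
  · obtain ⟨x, rfl⟩ := mem_mult_one.1 ha
    exact ⟨_, (long_mem_elem_top hψ _ _ _).2, map_long hψ hψ' h _ _⟩

end Functoriality

/-! ### The matrices `C_φ(v)` and `R_φ(v)` as transvections. -/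

section Vaserstein

variable {m : ℕ} {A : Type*} [CommRing A] {ψ : Matrix (Fin (m + 1)) (Fin (m + 1)) A}

/-- The first basis vector. -/
def firstVec (m : ℕ) (A : Type*) [CommRing A] : Fin (m + 1) → A := Pi.single 0 1

/-- The vector representing the first coordinate function for the form `ψ`. -/
noncomputable def dualVec (ψ : Matrix (Fin (m + 1)) (Fin (m + 1)) A) : Fin (m + 1) → A := ψ⁻¹ 0

theorem form_dualVec (hdet : IsUnit ψ.det) (x : Fin (m + 1) → A) : form ψ (dualVec ψ) x = x 0 := by
  have h : dualVec ψ ᵥ* ψ = Pi.single 0 1 := by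
    have := congrFun (Matrix.nonsing_inv_mul ψ hdet) 0
    ext i
    simpa [dualVec, Matrix.mul_apply, vecMul, dotProduct, Pi.single_apply, one_apply,
      eq_comm] using congrFun this i
  rw [← form_mulVec_eq, h, single_one_dotProduct]

theorem form_dualVec_firstVec (hdet : IsUnit ψ.det) :
    form ψ (dualVec ψ) (firstVec m A) = 1 := by
  simp [form_dualVec hdet, firstVec]

theorem form_firstVec (x : Fin (m + 1) → A) : form ψ (firstVec m A) x = (ψ *ᵥ x) 0 := by
  rw [form_apply, firstVec, single_one_dotProduct]

theorem dualVec_zero (hψ : IsAlternating ψ) (hdet : IsUnit ψ.det) : dualVec ψ 0 = 0 := by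
  rw [← form_dualVec hdet (dualVec ψ), hψ.form_self]

theorem dualVec_succ (i : Fin m) : dualVec ψ i.succ = blockD ψ i := rfl

theorem form_cons (v : Fin m → A) (x : Fin (m + 1) → A) :
    form ψ (Fin.cons 0 v) x = (v ⬝ᵥ blockC ψ) * x 0 + (v ᵥ* blockNu ψ) ⬝ᵥ Fin.tail x := by
  rw [form_apply, ← dotProduct_mulVec]
  simp only [dotProduct, mulVec, Fin.sum_univ_succ, Fin.cons_zero, Fin.cons_succ, zero_mul,
    zero_add, blockC, blockNu, submatrix_apply, Fin.tail, Finset.sum_mul, mul_add,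
    Finset.sum_add_distrib, mul_assoc]

theorem matC_mulVec (hψ : IsAlternating ψ) (hdet : IsUnit ψ.det) (v : Fin m → A)
    (x : Fin (m + 1) → A) :
    matC ψ v *ᵥ x = x + x 0 • (Fin.cons 0 v : Fin (m + 1) → A) +
      ((v ᵥ* blockNu ψ) ⬝ᵥ Fin.tail x) • dualVec ψ := by
  have h : alpha ψ v *ᵥ Fin.tail x =
      Fin.tail x + ((v ᵥ* blockNu ψ) ⬝ᵥ Fin.tail x) • blockD ψ := by
    rw [alpha, add_mulVec, one_mulVec, vecMulVec_mulVec, op_smul_eq_smul]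
  ext i
  refine Fin.cases ?_ (fun i => ?_) i
  · simp [matC, mulVec, dotProduct, Fin.sum_univ_succ, dualVec_zero hψ hdet]
  · have h1 : (matC ψ v *ᵥ x) i.succ = v i * x 0 + (alpha ψ v *ᵥ Fin.tail x) i := by
      simp [matC, mulVec, dotProduct, Fin.sum_univ_succ, Fin.tail]
    rw [h1, h]
    simp only [Pi.add_apply, Pi.smul_apply, smul_eq_mul, Fin.cons_succ, dualVec_succ, Fin.tail]
    ring

theorem matR_mulVec (hψ : IsAlternating ψ) (v : Fin m → A) (x : Fin (m + 1) → A) :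
    matR ψ v *ᵥ x = x + (v ⬝ᵥ Fin.tail x) • firstVec m A -
      form ψ (firstVec m A) x • (Fin.cons 0 (blockMu ψ *ᵥ v) : Fin (m + 1) → A) := by
  have hc : form ψ (firstVec m A) x = -(blockC ψ ⬝ᵥ Fin.tail x) := by
    have hj : ∀ j : Fin m, ψ j.succ 0 = -ψ 0 j.succ := fun j => congrFun (congrFun hψ.1 0) j.succ
    simp [form_firstVec, mulVec, dotProduct, Fin.sum_univ_succ, hψ.2, blockC, Fin.tail, hj]
  have h : beta ψ v *ᵥ Fin.tail x =
      Fin.tail x + (blockC ψ ⬝ᵥ Fin.tail x) • (blockMu ψ *ᵥ v) := by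
    rw [beta, add_mulVec, one_mulVec, vecMulVec_mulVec, op_smul_eq_smul]
  rw [hc]
  ext i
  refine Fin.cases ?_ (fun i => ?_) i
  · simp [matR, mulVec, dotProduct, Fin.sum_univ_succ, firstVec, Fin.tail]
  · have h1 : (matR ψ v *ᵥ x) i.succ = (beta ψ v *ᵥ Fin.tail x) i := by
      simp [matR, mulVec, dotProduct, Fin.sum_univ_succ, Fin.tail]
    rw [h1, h]
    simp [firstVec, Fin.tail]

theorem eq_of_matC (hψ : IsAlternating ψ) (hdet : IsUnit ψ.det) {w : Fin (m + 1) → A}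
    (hw : w ∈ perp ψ (dualVec ψ) (firstVec m A)) (a : A) :
    (short hψ (dualVec ψ) w * long hψ (dualVec ψ) a).1 =
      matC ψ (Fin.tail (w + a • dualVec ψ)) := by
  have hw' := mem_perp.1 hw
  have hff := hψ.form_self (dualVec ψ)
  have hef : form ψ (firstVec m A) (dualVec ψ) = -1 := by
    rw [hψ.form_neg (dualVec ψ), form_dualVec_firstVec hdet]
  set v := Fin.tail (w + a • dualVec ψ) with hv
  have hcons : (Fin.cons 0 v : Fin (m + 1) → A) = w + a • dualVec ψ := by
    conv_rhs => rw [← Fin.cons_self_tail (w + a • dualVec ψ)]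
    congr 1
    rw [← form_dualVec hdet (w + a • dualVec ψ), map_add, map_smul, hw'.1, hff]
    simp
  have hva : v ⬝ᵥ blockC ψ = a := by
    have h1 := form_cons (ψ := ψ) v (firstVec m A)
    have h2 : Fin.tail (firstVec m A) = 0 := by
      ext i
      simp [Fin.tail, firstVec]
    rw [hcons, h2, dotProduct_zero, map_add, map_smul, LinearMap.add_apply, LinearMap.smul_apply,
      form_dualVec_firstVec hdet, hψ.form_swap hw'.2] at h1
    simpa [firstVec] using h1.symm
  refine Matrix.toLin'.injective (LinearMap.ext fun x => ?_)
  have h3 := form_cons (ψ := ψ) v x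
  rw [hcons, hva, map_add, map_smul, LinearMap.add_apply, LinearMap.smul_apply,
    form_dualVec hdet, smul_eq_mul] at h3
  have h4 : (v ᵥ* blockNu ψ) ⬝ᵥ Fin.tail x = form ψ w x := by linear_combination -h3
  rw [toLin'_apply, toLin'_apply, matC_mulVec hψ hdet, hcons, h4, Units.val_mul, ← mulVec_mulVec,
    short_mulVec hψ hw'.1, long_mulVec, map_add, map_add, map_smul, map_smul, hff,
    hψ.form_swap hw'.1, form_dualVec hdet]
  module

theorem eq_of_matR (hψ : IsAlternating ψ) (hdet : IsUnit ψ.det) {w : Fin (m + 1) → A}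
    (hw : w ∈ perp ψ (dualVec ψ) (firstVec m A)) (a : A) :
    (short hψ (firstVec m A) w * long hψ (firstVec m A) a).1 =
      matR ψ (Fin.tail ((w + a • firstVec m A) ᵥ* ψ)) := by
  have hw' := mem_perp.1 hw
  set e := firstVec m A with he
  have hee := hψ.form_self e
  have h0 : ((w + a • e) ᵥ* ψ) 0 = 0 := by
    have : form ψ (w + a • e) e = 0 := by
      simp [hψ.form_swap hw'.2, hee]
    rwa [← form_mulVec_eq, he, firstVec, dotProduct_single_one] at this
  set v := Fin.tail ((w + a • e) ᵥ* ψ) with hv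
  have hcons : (Fin.cons 0 v : Fin (m + 1) → A) = (w + a • e) ᵥ* ψ := by
    conv_rhs => rw [← Fin.cons_self_tail ((w + a • e) ᵥ* ψ)]
    rw [h0]
  have hz : ψ⁻¹ *ᵥ Fin.cons 0 v = -(w + a • e) := by
    have h1 : (w + a • e) ᵥ* ψ = -(ψ *ᵥ (w + a • e)) := by
      rw [← mulVec_transpose, hψ.1, neg_mulVec]
    rw [hcons, h1, mulVec_neg, mulVec_mulVec, Matrix.nonsing_inv_mul ψ hdet, one_mulVec]
  have hmu : (Fin.cons 0 (blockMu ψ *ᵥ v) : Fin (m + 1) → A) = -w := by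
    have hz' : ∀ i, ψ⁻¹ i ⬝ᵥ (Fin.cons 0 v : Fin (m + 1) → A) = -(w i + a * e i) := fun i => by
      simpa [mulVec, e] using congrFun hz i
    ext i
    refine Fin.cases ?_ (fun i => ?_) i
    · rw [Pi.neg_apply, ← form_dualVec hdet w, hw'.1, Fin.cons_zero, neg_zero]
    · have := hz' i.succ
      simp only [dotProduct, Fin.sum_univ_succ, Fin.cons_zero, Fin.cons_succ, mul_zero, zero_add,
        he, firstVec, Pi.single_apply, Fin.succ_ne_zero, if_false, add_zero] at this
      simpa [mulVec, dotProduct, blockMu] using this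
  refine Matrix.toLin'.injective (LinearMap.ext fun x => ?_)
  have h3 : v ⬝ᵥ Fin.tail x = form ψ (w + a • e) x := by
    rw [← form_mulVec_eq, ← hcons]
    simp [dotProduct, Fin.sum_univ_succ, Fin.tail]
  rw [toLin'_apply, toLin'_apply, matR_mulVec hψ, hmu, h3, Units.val_mul, ← mulVec_mulVec,
    short_mulVec hψ hw'.2, long_mulVec]
  simp only [map_add, map_smul, ← he, hee, hψ.form_swap hw'.2, LinearMap.add_apply,
    LinearMap.smul_apply, smul_eq_mul]
  module

/-- The `C_φ(v)` and `R_φ(v)` are exactly the elements of the two opposite Heisenberg groups,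
attached to `dualVec ψ` and `firstVec`. For `C_φ` the parameter `(0, v)` is split as `w + a •
dualVec ψ`; for `R_φ` the split vector is the one representing `(0, v)` through `ψ`. -/
theorem ESp_eq_elem (hψ : IsAlternating ψ) (hdet : IsUnit ψ.det) :
    ESp ψ = elem hψ (dualVec ψ) (firstVec m A) ⊤ 1 := by
  have hff := hψ.form_self (dualVec ψ)
  have hfe := form_dualVec_firstVec hdet
  have hef : form ψ (firstVec m A) (dualVec ψ) = -1 := by
    rw [hψ.form_neg (dualVec ψ), form_dualVec_firstVec hdet]
  apply le_antisymm
  · refine (Subgroup.closure_le _).2 ?_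
    rintro g ⟨v, hg | hg⟩
    · set y : Fin (m + 1) → A := Fin.cons 0 v with hy
      set a := form ψ y (firstVec m A) with ha
      have hw : y - a • dualVec ψ ∈ perp ψ (dualVec ψ) (firstVec m A) := by
        rw [mem_perp]
        constructor
        · simp [form_dualVec hdet, dualVec_zero hψ hdet, hy]
        · rw [map_sub, map_smul, hef, ha, hψ.form_neg y]
          simp
      have key := eq_of_matC hψ hdet hw a
      rw [sub_add_cancel, hy, Fin.tail_cons, ← hg] at key
      rw [SetLike.mem_coe, ← Units.ext key]
      exact mul_mem (short_mem_elem_top hψ hw).1 (long_mem_elem_top hψ _ _ _).1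
    · set y : Fin (m + 1) → A := Fin.cons 0 v with hy
      set z := -(ψ⁻¹ *ᵥ y) with hz
      have hzψ : z ᵥ* ψ = y := by
        rw [← mulVec_transpose, hψ.1, hz, neg_mulVec, mulVec_neg, neg_neg, mulVec_mulVec,
          Matrix.mul_nonsing_inv ψ hdet, one_mulVec]
      have hw : z - z 0 • firstVec m A ∈ perp ψ (dualVec ψ) (firstVec m A) := by
        rw [mem_perp]
        constructor
        · simp [form_dualVec hdet, firstVec]
        · have : form ψ z (firstVec m A) = 0 := by
            rw [← form_mulVec_eq, hzψ, firstVec, dotProduct_single_one, hy, Fin.cons_zero]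
          rw [map_sub, map_smul, hψ.form_self, hψ.form_swap this]
          simp
      have key := eq_of_matR hψ hdet hw (z 0)
      rw [sub_add_cancel, hzψ, hy, Fin.tail_cons, ← hg] at key
      rw [SetLike.mem_coe, ← Units.ext key]
      exact mul_mem (short_mem_elem_top hψ hw).2 (long_mem_elem_top hψ _ _ _).2
  · have hC : ∀ w ∈ perp ψ (dualVec ψ) (firstVec m A), ∀ a,
        short hψ (dualVec ψ) w * long hψ (dualVec ψ) a ∈ ESp ψ := fun w hw a =>
      Subgroup.subset_closure ⟨_, Or.inl (eq_of_matC hψ hdet hw a)⟩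
    have hR : ∀ w ∈ perp ψ (dualVec ψ) (firstVec m A), ∀ a,
        short hψ (firstVec m A) w * long hψ (firstVec m A) a ∈ ESp ψ := fun w hw a =>
      Subgroup.subset_closure ⟨_, Or.inr (eq_of_matR hψ hdet hw a)⟩
    refine elem_le_of (fun w _ hw => ?_) (fun w _ hw => ?_) (fun a _ => ?_) (fun a _ => ?_)
    · simpa [long_zero] using hC w hw 0
    · simpa [long_zero] using hR w hw 0
    · simpa [short_zero] using hC 0 (zero_mem _) a
    · simpa [short_zero] using hR 0 (zero_mem _) a

variable {A' : Type*} [CommRing A'] (σ : A →+* A')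

theorem isUnit_det_map (hdet : IsUnit ψ.det) : IsUnit (ψ.map σ).det := by
  have := hdet.map σ
  rwa [RingHom.map_det] at this

theorem comp_firstVec : σ ∘ firstVec m A = firstVec m A' := by
  ext i
  simp [firstVec, Pi.single_apply, apply_ite σ]

theorem comp_dualVec (hdet : IsUnit ψ.det) : σ ∘ dualVec ψ = dualVec (ψ.map σ) := by
  have h : (ψ.map σ)⁻¹ = ψ⁻¹.map σ := by
    refine Matrix.inv_eq_left_inv ?_
    rw [← Matrix.map_mul, Matrix.nonsing_inv_mul ψ hdet]
    simp
  simp only [dualVec, h]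
  rfl

theorem map_mem_ESp (hψ : IsAlternating ψ) (hdet : IsUnit ψ.det) {g : GL (Fin (m + 1)) A}
    (hg : g ∈ ESp ψ) : GeneralLinearGroup.map σ g ∈ ESp (ψ.map σ) := by
  rw [ESp_eq_elem hψ hdet] at hg
  rw [ESp_eq_elem (hψ.map σ) (isUnit_det_map σ hdet), ← comp_dualVec σ hdet,
    ← comp_firstVec σ]
  exact map_mem_elem hψ _ rfl hg

end Vaserstein

/-! ### The dilation principle. -/

section Dilation

open Polynomial

variable {B B' : Type*} [CommRing B] [CommRing B']

/-- `ρ` has the properties of a localization map at `M`. -/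
structure IsLoc (M : Submonoid B) (ρ : B →+* B') : Prop where
  isUnit : ∀ m ∈ M, IsUnit (ρ m)
  surj : ∀ b', ∃ m ∈ M, ∃ b, ρ m * b' = ρ b
  zero : ∀ b, ρ b = 0 → ∃ m ∈ M, m * b = 0

theorem isLoc_algebraMap (M : Submonoid B) [Algebra B B'] [IsLocalization M B'] :
    IsLoc M (algebraMap B B') where
  isUnit m hm := IsLocalization.map_units B' ⟨m, hm⟩
  surj b' := by
    obtain ⟨⟨b, m⟩, h⟩ := IsLocalization.surj M b'
    exact ⟨m, m.2, b, by rw [mul_comm, h]⟩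
  zero b hb := by
    obtain ⟨m, h⟩ := (IsLocalization.map_eq_zero_iff M B' b).1 hb
    exact ⟨m, m.2, h⟩

theorem IsLoc.polynomial {M : Submonoid B} {ρ : B →+* B'} (h : IsLoc M ρ) :
    IsLoc (M.map (C : B →+* B[X])) (mapRingHom ρ) where
  isUnit := by
    rintro _ ⟨m, hm, rfl⟩
    simpa using (h.isUnit m hm).map C
  surj p := by
    induction p using Polynomial.induction_on' with
    | add p q hp hq =>
      obtain ⟨m, hm, p', hp⟩ := hp
      obtain ⟨n, hn, q', hq⟩ := hq
      refine ⟨m * n, mul_mem hm hn, n * p' + m * q', ?_⟩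
      rw [map_add, map_mul, map_mul, map_mul, ← hp, ← hq]
      ring
    | monomial k a =>
      obtain ⟨m, hm, b, hb⟩ := h.surj a
      refine ⟨C m, ⟨m, hm, rfl⟩, monomial k b, ?_⟩
      simp [C_mul_monomial, hb]
  zero p hp := by
    have : ∀ i, ∃ m ∈ M, m * p.coeff i = 0 := fun i => h.zero _ (by
      simpa using congrArg (fun q => q.coeff i) hp)
    choose m hm hmp using this
    refine ⟨C (∏ i ∈ p.support, m i), ⟨_, M.prod_mem fun i _ => hm i, rfl⟩, ?_⟩
    ext i
    rw [coeff_C_mul, coeff_zero]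
    by_cases hi : i ∈ p.support
    · rw [← Finset.prod_erase_mul _ _ hi, mul_assoc, hmp, mul_zero]
    · rw [notMem_support_iff.1 hi, mul_zero]

/-- The substitution `X ↦ a X`. -/
noncomputable def scale (a : B) : B[X] →+* B[X] := compRingHom (C a * X)

theorem scale_apply (a : B) (p : B[X]) : scale a p = p.comp (C a * X) := rfl

theorem scale_C (a b : B) : scale a (C b) = C b := by simp [scale_apply]

theorem scale_zero_apply (p : B[X]) : scale 0 p = C (p.coeff 0) := by
  simp [scale_apply, coeff_zero_eq_eval_zero]

theorem scale_scale (a b : B) (p : B[X]) : scale a (scale b p) = scale (a * b) p := by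
  simp only [scale_apply, comp_assoc, mul_comp, C_comp, X_comp, ← mul_assoc, C_mul]
  rw [mul_comm (C a)]

theorem scale_comp (a b : B) : (scale a).comp (scale b) = scale (a * b) :=
  RingHom.ext (scale_scale a b)

theorem scale_sub (a : B) (p : B[X]) : scale a p - scale 0 p = scale a (divX p) * (C a * X) := by
  have h := congrArg (scale a) (divX_mul_X_add p)
  rw [map_add, map_mul, scale_C] at h
  rw [← h, scale_zero_apply, scale_apply a X, X_comp]
  ring

theorem map_scale (ρ : B →+* B') (a : B) (p : B[X]) :
    mapRingHom ρ (scale a p) = scale (ρ a) (mapRingHom ρ p) := by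
  simp [scale_apply, Polynomial.map_comp]

theorem map_divX (ρ : B →+* B') (p : B[X]) : mapRingHom ρ (divX p) = divX (mapRingHom ρ p) := by
  ext i
  simp

variable {M : Submonoid B} {ρ : B →+* B'}

/-- Constants coming from `M`. -/
noncomputable def constMonoid (M : Submonoid B) (ρ : B →+* B') : Submonoid B'[X] := M.map (C.comp ρ)

theorem mem_constMonoid {m : B} (hm : m ∈ M) : C (ρ m) ∈ constMonoid M ρ := ⟨m, hm, rfl⟩

theorem IsLoc.scale_small (h : IsLoc M ρ) {s : B} (hs : s ∈ M) (p : B'[X]) :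
    ∀ᶠ t in divFilter M, scale (ρ t) p - scale 0 p ∈ mult (mapRingHom ρ).range (C (ρ s)) := by
  obtain ⟨_, ⟨m, hm, rfl⟩, q, hq⟩ := h.polynomial.surj p
  filter_upwards [eventually_dvd (mul_mem hs hm)] with t ⟨r, _, ht⟩
  refine ⟨mapRingHom ρ (scale t (divX q) * (C r * X)), ⟨_, rfl⟩, ?_⟩
  have hq' : mapRingHom ρ (divX q) = C (ρ m) * divX p := by
    rw [map_divX, ← hq]
    simp [divX_C_mul]
  rw [scale_sub, map_mul, map_scale, hq', map_mul (scale _), scale_C, ht]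
  simp only [map_mul, coe_mapRingHom, map_C, map_X]
  ring

variable {ι : Type*} [Fintype ι] [DecidableEq ι] {ψ : Matrix ι ι B} {e f u v : ι → B}

theorem IsLoc.frame (h : IsLoc M ρ) (hψ' : IsAlternating (ψ.map (C.comp ρ)))
    (hef : form ψ e f = 1) (hu : u ∈ perp ψ e f) (hv : v ∈ perp ψ e f) (huv : form ψ u v ∈ M) :
    Frame hψ' (mapRingHom ρ).range (constMonoid M ρ) (C.comp ρ ∘ e) (C.comp ρ ∘ f)
      (C.comp ρ ∘ u) (C.comp ρ ∘ v) := by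
  have hC : ∀ b : B, C (ρ b) ∈ (mapRingHom ρ).range := fun b => ⟨C b, by simp⟩
  refine ⟨fun i j => hC _, ?_, ?_, fun p => ?_, fun i => hC _, fun i => hC _, fun i => hC _,
    fun i => hC _, ?_, map_mem_perp rfl hu, map_mem_perp rfl hv, ?_⟩
  · rintro _ ⟨m, -, rfl⟩
    exact hC m
  · rintro _ ⟨m, hm, rfl⟩
    exact (h.isUnit m hm).map C
  · obtain ⟨_, ⟨m, hm, rfl⟩, q, hq⟩ := h.polynomial.surj p
    refine ⟨_, mem_constMonoid hm, q, ?_⟩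
    rw [← hq]
    simp
  · rw [← map_form rfl, hef, map_one]
  · rw [← map_form rfl]
    exact mem_constMonoid huv

/-- On generators this holds because `p(tX) - p(0)` is divisible by `t`; continuity of conjugation
by `g(0)` carries it to products and inverses. -/
theorem IsLoc.scale_mul_inv_small (h : IsLoc M ρ) (hψ' : IsAlternating (ψ.map (C.comp ρ)))
    (hef : form ψ e f = 1) (hu : u ∈ perp ψ e f) (hv : v ∈ perp ψ e f) (huv : form ψ u v ∈ M)
    {g : GL ι B'[X]} (hg : g ∈ elem hψ' (C.comp ρ ∘ e) (C.comp ρ ∘ f) ⊤ 1) :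
    ∀ s ∈ M, ∀ᶠ t in divFilter M,
      GeneralLinearGroup.map (scale (ρ t)) g * (GeneralLinearGroup.map (scale 0) g)⁻¹ ∈
        elem hψ' (C.comp ρ ∘ e) (C.comp ρ ∘ f) (mapRingHom ρ).range (C (ρ s)) := by
  have F := h.frame hψ' hef hu hv huv
  set e' := C.comp ρ ∘ e with he'
  set f' := C.comp ρ ∘ f with hf'
  have hsc : ∀ a : B', (ψ.map (C.comp ρ)).map (scale a) = ψ.map (C.comp ρ) := fun a => by
    ext1 i j
    simp [scale_C]
  have hse : ∀ a : B', scale a ∘ e' = e' := fun a => by ext1 i; simp [he', scale_C]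
  have hsf : ∀ a : B', scale a ∘ f' = f' := fun a => by ext1 i; simp [hf', scale_C]
  have hperp : ∀ (a : B') {w : ι → B'[X]}, w ∈ perp (ψ.map (C.comp ρ)) e' f' →
      scale a ∘ w ∈ perp (ψ.map (C.comp ρ)) e' f' := fun a w hw => by
    have := map_mem_perp (hsc a) hw
    rwa [hse, hsf] at this
  have hmem : ∀ {g : GL ι B'[X]}, g ∈ elem hψ' e' f' ⊤ 1 →
      GeneralLinearGroup.map (scale 0) g ∈ elem hψ' e' f' ⊤ 1 := fun hg => by
    have := map_mem_elem hψ' hψ' (hsc 0) hg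
    rwa [hse, hsf] at this
  have hshort : ∀ (x : ι → B'[X]), (∀ a : B', scale a ∘ x = x) →
      (∀ s, ∀ w ∈ vmult ι (mapRingHom ρ).range s, w ∈ perp (ψ.map (C.comp ρ)) e' f' →
        short hψ' x w ∈ elem hψ' e' f' (mapRingHom ρ).range s) →
      (∀ s, ∀ a ∈ mult (mapRingHom ρ).range s,
        long hψ' x a ∈ elem hψ' e' f' (mapRingHom ρ).range s) →
      ∀ w ∈ perp (ψ.map (C.comp ρ)) e' f', form (ψ.map (C.comp ρ)) x w = 0 →
      (∀ a : B', form (ψ.map (C.comp ρ)) x (scale a ∘ w) = 0) →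
      ∀ s ∈ M, ∀ᶠ t in divFilter M, GeneralLinearGroup.map (scale (ρ t)) (short hψ' x w) *
        (GeneralLinearGroup.map (scale 0) (short hψ' x w))⁻¹ ∈
        elem hψ' e' f' (mapRingHom ρ).range (C (ρ s)) := by
    intro x hx hs1 hl1 w hw hxw hxw' s hs
    set w₀ := scale (0 : B') ∘ w with hw₀
    have hw0 : w₀ ∈ perp (ψ.map (C.comp ρ)) e' f' := hperp 0 hw
    -- The constant part `w₀` may have denominators; `r` absorbs them in the Heisenberg correction
    -- `B(y, w₀)`, where `y = w(tX) - w₀`.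
    obtain ⟨_, ⟨r, hr, rfl⟩, hr'⟩ := exists_of_eventually
      (F.form_small w₀ (mem_constMonoid hs))
    filter_upwards [Filter.eventually_all.2 fun i => h.scale_small (mul_mem hs hr) (w i)] with t ht
    have hy : scale (ρ t) ∘ w - w₀ ∈ vmult ι (mapRingHom ρ).range (C (ρ s) * C (ρ r)) := by
      intro i
      simpa [hw₀] using ht i
    have hC : ∀ b : B, C (ρ b) ∈ (mapRingHom ρ).range := fun b => ⟨C b, by simp⟩
    have hy1 := mem_vmult_of_dvd (hC r) hy
    have hy2 := mem_vmult_of_dvd (hC s) (mul_comm (C (ρ s)) (C (ρ r)) ▸ hy)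
    have hy3 : scale (ρ t) ∘ w - w₀ ∈ perp (ψ.map (C.comp ρ)) e' f' := sub_mem (hperp _ hw) hw0
    have hxy : form (ψ.map (C.comp ρ)) x (scale (ρ t) ∘ w - w₀) = 0 := by
      rw [map_sub, hxw', hxw', sub_zero]
    rw [map_short hψ' hψ' (hsc _), map_short hψ' hψ' (hsc _), hx, hx]
    have e1 : scale (ρ t) ∘ w = (scale (ρ t) ∘ w - w₀) + w₀ := by abel
    have hcomm : ∀ a, short hψ' x w₀ * long hψ' x a * (short hψ' x w₀)⁻¹ = long hψ' x a := by
      intro a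
      rw [(isom_short _ _).conj_long, short_mulVec hψ' (hxw' 0), hψ'.form_self,
        hψ'.form_swap (hxw' 0)]
      simp
    rw [e1, short_add hψ' hxy (hxw' 0), mul_assoc, mul_assoc, ← mul_assoc (short hψ' x w₀), hcomm]
    refine mul_mem (hs1 _ _ hy1 hy3) (hl1 _ _ (neg_mem ?_))
    rw [hψ'.form_neg w₀]
    exact neg_mem (hr' _ hy2)
  have hlong : ∀ (x : ι → B'[X]), (∀ a : B', scale a ∘ x = x) →
      (∀ s, ∀ a ∈ mult (mapRingHom ρ).range s,
        long hψ' x a ∈ elem hψ' e' f' (mapRingHom ρ).range s) →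
      ∀ p : B'[X], ∀ s ∈ M, ∀ᶠ t in divFilter M,
        GeneralLinearGroup.map (scale (ρ t)) (long hψ' x p) *
        (GeneralLinearGroup.map (scale 0) (long hψ' x p))⁻¹ ∈
        elem hψ' e' f' (mapRingHom ρ).range (C (ρ s)) := by
    intro x hx hl1 p s hs
    filter_upwards [h.scale_small hs p] with t ht
    rw [map_long hψ' hψ' (hsc _), map_long hψ' hψ' (hsc _), hx, hx, ← long_neg, ← long_add,
      ← sub_eq_add_neg]
    exact hl1 _ _ ht
  refine Subgroup.closure_induction (p := fun g _ => ∀ s ∈ M, ∀ᶠ t in divFilter M,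
      GeneralLinearGroup.map (scale (ρ t)) g * (GeneralLinearGroup.map (scale 0) g)⁻¹ ∈
        elem hψ' e' f' (mapRingHom ρ).range (C (ρ s))) ?_ ?_ ?_ ?_ hg
  · rintro g (⟨w, -, hw, rfl | rfl⟩ | ⟨a, -, rfl | rfl⟩)
    · exact hshort e' hse (fun _ _ => short_e_mem) (fun _ _ => long_e_mem) w hw (mem_perp.1 hw).1
        fun a => (mem_perp.1 (hperp a hw)).1
    · exact hshort f' hsf (fun _ _ => short_f_mem) (fun _ _ => long_f_mem) w hw (mem_perp.1 hw).2
        fun a => (mem_perp.1 (hperp a hw)).2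
    · exact hlong e' hse (fun _ _ => long_e_mem) a
    · exact hlong f' hsf (fun _ _ => long_f_mem) a
  · intro s hs
    exact Filter.Eventually.of_forall fun t => by simp
  · intro g k hg hk Hg Hk s hs
    -- `(gk)(tX) (gk)(0)⁻¹` is `g(tX) g(0)⁻¹` times the conjugate of `k(tX) k(0)⁻¹` by `g(0)`.
    obtain ⟨_, ⟨r, hr, rfl⟩, hr'⟩ := exists_of_eventually
      (F.conjCont (hmem hg) _ (mem_constMonoid hs))
    filter_upwards [Hg s hs, Hk r hr] with t h1 h2
    have h3 := mul_mem h1 (mem_conjElem.1 (hr' h2))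
    convert h3 using 1
    rw [map_mul, map_mul]
    group
  · intro g hg Hg s hs
    obtain ⟨_, ⟨r, hr, rfl⟩, hr'⟩ := exists_of_eventually
      (F.conjCont (inv_mem (hmem hg)) _ (mem_constMonoid hs))
    filter_upwards [Hg r hr] with t h1
    have h3 := inv_mem (mem_conjElem.1 (hr' h1))
    convert h3 using 1
    rw [map_inv, map_inv]
    group

/-- Matrices equal to `1` modulo `X` and over the localization become `1` after dilation. -/
theorem IsLoc.exists_scale_eq_one (h : IsLoc M ρ) {δ : GL ι B[X]}
    (h0 : GeneralLinearGroup.map (scale 0) δ = 1)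
    (h1 : GeneralLinearGroup.map (mapRingHom ρ) δ = 1) :
    ∃ t ∈ M, GeneralLinearGroup.map (scale t) δ = 1 := by
  -- Allowing all multiples `r * t` lets one product serve every entry.
  have key : ∀ i j, ∃ t ∈ M, ∀ r, scale (r * t) (δ i j) = (1 : Matrix ι ι B[X]) i j := by
    intro i j
    have a0 : scale 0 (δ i j) = (1 : Matrix ι ι B[X]) i j := by
      rw [← GeneralLinearGroup.map_apply, h0]
      rfl
    have a1 : mapRingHom ρ (divX (δ i j)) = 0 := by
      rw [map_divX, ← GeneralLinearGroup.map_apply, h1, Units.val_one, Matrix.one_apply]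
      split_ifs
      · rw [← C_1, divX_C]
      · exact divX_zero
    obtain ⟨_, ⟨m, hm, rfl⟩, hm'⟩ := h.polynomial.zero _ a1
    refine ⟨m, hm, fun r => ?_⟩
    have hm2 := congrArg (scale (r * m)) hm'
    rw [map_mul, scale_C, map_zero] at hm2
    have := scale_sub (r * m) (δ i j)
    rw [a0, sub_eq_iff_eq_add] at this
    rw [this, C_mul]
    linear_combination C r * X * hm2
  choose t ht H using key
  refine ⟨∏ p : ι × ι, t p.1 p.2, M.prod_mem fun p _ => ht _ _,
    GeneralLinearGroup.ext fun i j => ?_⟩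
  rw [GeneralLinearGroup.map_apply, ← Finset.prod_erase_mul _ _ (Finset.mem_univ (i, j)), H]
  rfl

/-- **Dilation principle.** -/
theorem IsLoc.dilation (h : IsLoc M ρ) (hψ : IsAlternating (ψ.map (C : B →+* B[X])))
    (hψ' : IsAlternating (ψ.map (C.comp ρ)))
    (hef : form ψ e f = 1) (hu : u ∈ perp ψ e f) (hv : v ∈ perp ψ e f) (huv : form ψ u v ∈ M)
    {θ : GL ι B[X]} (h0 : GeneralLinearGroup.map (scale 0) θ = 1)
    (hθ : GeneralLinearGroup.map (mapRingHom ρ) θ ∈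
      elem hψ' (C.comp ρ ∘ e) (C.comp ρ ∘ f) ⊤ 1) :
    ∃ t ∈ M, GeneralLinearGroup.map (scale t) θ ∈
      elem hψ ((C : B →+* B[X]) ∘ e) ((C : B →+* B[X]) ∘ f) ⊤ 1 := by
  obtain ⟨t, ht, ht'⟩ := exists_of_eventually
    (h.scale_mul_inv_small hψ' hef hu hv huv hθ 1 M.one_mem)
  have hcomm : ∀ a : B, (mapRingHom ρ).comp (scale a) = (scale (ρ a)).comp (mapRingHom ρ) :=
    fun a => RingHom.ext (map_scale ρ a)
  have hcomm' : ∀ (a : B) (g : GL ι B[X]), GeneralLinearGroup.map (scale (ρ a))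
      (GeneralLinearGroup.map (mapRingHom ρ) g) =
      GeneralLinearGroup.map (mapRingHom ρ) (GeneralLinearGroup.map (scale a) g) := fun a g => by
    rw [gl_map_map, gl_map_map, hcomm]
  have hss : ∀ (a b : B) (g : GL ι B[X]), GeneralLinearGroup.map (scale a)
      (GeneralLinearGroup.map (scale b) g) = GeneralLinearGroup.map (scale (a * b)) g :=
    fun a b g => by
      rw [gl_map_map, scale_comp]
  have hz := hcomm' 0 θ
  rw [map_zero, h0, map_one] at hz
  rw [hz, inv_one, mul_one, map_one, map_one, hcomm'] at ht'
  have hψC : (ψ.map (C : B →+* B[X])).map (mapRingHom ρ) = ψ.map (C.comp ρ) := by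
    ext1 i j
    simp
  have hvec : ∀ x : ι → B, (mapRingHom ρ) ∘ ((C : B →+* B[X]) ∘ x) = C.comp ρ ∘ x := fun x => by
    ext1 i
    simp
  have hef' : form (ψ.map (C : B →+* B[X])) (C ∘ e) (C ∘ f) = 1 := by
    have := map_form (σ := (C : B →+* B[X])) (ψ := ψ) rfl e f
    rw [hef, map_one] at this
    exact this.symm
  have hle := elem_range_le hψ hψ' hψC hef'
  rw [hvec, hvec] at hle
  obtain ⟨ξ, hξ, hξ'⟩ := hle ht'
  have hsc : ∀ a : B, (ψ.map (C : B →+* B[X])).map (scale a) = ψ.map C := fun a => by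
    ext1 i j
    simp [scale_C]
  have hsv : ∀ (a : B) (x : ι → B), scale a ∘ ((C : B →+* B[X]) ∘ x) = C ∘ x := fun a x => by
    ext1 i
    simp [scale_C]
  have hmem : ∀ (a : B) {g : GL ι B[X]}, g ∈ elem hψ (C ∘ e) (C ∘ f) ⊤ 1 →
      GeneralLinearGroup.map (scale a) g ∈ elem hψ (C ∘ e) (C ∘ f) ⊤ 1 := fun a g hg => by
    have := map_mem_elem hψ hψ (hsc a) hg
    rwa [hsv, hsv] at this
  -- The lift `ξ` is normalized to be `1` at `X = 0`; its image is unchanged since `ξ(0)` maps to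
  -- `1`. What remains is an error trivial both at `X = 0` and over the localization, which a
  -- further dilation removes.
  set ζ := ξ * (GeneralLinearGroup.map (scale 0) ξ)⁻¹ with hζ
  have hζmem : ζ ∈ elem hψ (C ∘ e) (C ∘ f) ⊤ 1 := mul_mem hξ (inv_mem (hmem 0 hξ))
  have hξ0 : GeneralLinearGroup.map (mapRingHom ρ) (GeneralLinearGroup.map (scale 0) ξ) = 1 := by
    rw [← hcomm', hξ', hcomm', hss, zero_mul, h0, map_one]
  obtain ⟨r, hr, hr'⟩ := h.exists_scale_eq_one (δ := GeneralLinearGroup.map (scale t) θ * ζ⁻¹)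
    (by
      rw [map_mul, hss, zero_mul, h0, map_inv, hζ, map_mul, map_inv, hss, zero_mul,
        mul_inv_cancel, inv_one, one_mul])
    (by rw [map_mul, map_inv, hζ, map_mul, map_inv, hξ0, hξ', inv_one, mul_one, mul_inv_cancel])
  refine ⟨r * t, mul_mem hr ht, ?_⟩
  rw [map_mul, map_inv, mul_inv_eq_one, hss] at hr'
  rw [hr']
  exact hmem r hζmem

end Dilation

/-! ### Invertibility from the Pfaffian. -/

section Pfaffian

open CliffordAlgebra

variable {R N : Type*} [CommRing R] [AddCommGroup N] [Module R N]

theorem contractLeft_ιMulti (d : Module.Dual R N) : ∀ (n : ℕ) (v : Fin (n + 1) → N),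
    contractLeft (Q := (0 : QuadraticForm R N)) d (ExteriorAlgebra.ιMulti R (n + 1) v) =
      ∑ j : Fin (n + 1), ((-1) ^ (j : ℕ) * d (v j)) •
        ExteriorAlgebra.ιMulti R n (fun i => v (j.succAbove i))
  | 0, v => by
    rw [ExteriorAlgebra.ιMulti_succ_apply, ExteriorAlgebra.ι, contractLeft_ι_mul]
    simp
  | n + 1, v => by
    rw [ExteriorAlgebra.ιMulti_succ_apply, ExteriorAlgebra.ι, contractLeft_ι_mul,
      contractLeft_ιMulti d n, Finset.mul_sum, sub_eq_add_neg, ← Finset.sum_neg_distrib,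
      Fin.sum_univ_succ (n := n + 1)]
    congr 1
    · simp [Matrix.vecTail, Function.comp_def]
    · refine Finset.sum_congr rfl fun j _ => ?_
      rw [mul_smul_comm, ← neg_smul, ExteriorAlgebra.ιMulti_succ_apply, ExteriorAlgebra.ι]
      simp [Matrix.vecTail, Function.comp_def, pow_succ]

variable {b : LinearMap.BilinForm R N} (hb : b.IsAlt)

include hb in
theorem toQuadraticMap_neg_eq : (-b).toQuadraticMap =
    (0 : QuadraticForm R N) - (0 : QuadraticForm R N) := by
  ext x
  simp [hb.self_eq_zero x]

/-- The Pfaffian of the Gram matrix, as an alternating function of the vectors. -/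
noncomputable def pfaffianMap (n : ℕ) : N [⋀^Fin n]→ₗ[R] R :=
  ((ExteriorAlgebra.algebraMapInv (R := R) (M := N)).toLinearMap ∘ₗ
    changeForm (toQuadraticMap_neg_eq hb)).compAlternatingMap (ExteriorAlgebra.ιMulti R n)

theorem pfaffianMap_apply (n : ℕ) (v : Fin n → N) :
    pfaffianMap hb n v = ExteriorAlgebra.algebraMapInv (changeForm (toQuadraticMap_neg_eq hb)
      (ExteriorAlgebra.ιMulti R n v)) := rfl

/-- `changeForm` turns multiplication by `v 0` into multiplication plus contraction with `b (v 0)`;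
only the contraction survives in the scalar part, and it yields the first-row expansion. -/
theorem pfaffianMap_succ_succ (n : ℕ) (v : Fin (n + 2) → N) :
    pfaffianMap hb (n + 2) v = ∑ j : Fin (n + 1), (-1) ^ (j : ℕ) * b (v 0) (v j.succ) *
      pfaffianMap hb n (fun i => v (j.succAbove i).succ) := by
  rw [pfaffianMap_apply, ExteriorAlgebra.ιMulti_succ_apply, ExteriorAlgebra.ι, changeForm_ι_mul,
    ← changeForm_contractLeft, contractLeft_ιMulti, map_sub, map_mul]
  have h0 : ExteriorAlgebra.algebraMapInv (R := R) (M := N) (ι 0 (v 0)) = 0 := by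
    change ExteriorAlgebra.algebraMapInv (ExteriorAlgebra.ι R (v 0)) = 0
    simp [ExteriorAlgebra.algebraMapInv]
  rw [h0, zero_mul, zero_sub, map_sum, map_sum, ← Finset.sum_neg_distrib]
  refine Finset.sum_congr rfl fun j _ => ?_
  rw [map_smul, map_smul, pfaffianMap_apply]
  simp [Matrix.vecTail]

theorem pfaffian_gram : ∀ (n : ℕ) (v : Fin n → N),
    pfaffian n (Matrix.of fun i j => b (v i) (v j)) = pfaffianMap hb n v
  | 0, v => by
    rw [pfaffianMap_apply, ExteriorAlgebra.ιMulti_zero_apply, changeForm_one, map_one, pfaffian]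
  | 1, v => by
    rw [pfaffianMap_apply, ExteriorAlgebra.ιMulti_succ_apply, ExteriorAlgebra.ιMulti_zero_apply,
      mul_one, ExteriorAlgebra.ι, changeForm_ι, pfaffian]
    change 0 = ExteriorAlgebra.algebraMapInv (ExteriorAlgebra.ι R (v 0))
    simp [ExteriorAlgebra.algebraMapInv]
  | n + 2, v => by
    rw [pfaffianMap_succ_succ, pfaffian]
    refine Finset.sum_congr rfl fun j _ => ?_
    rw [← pfaffian_gram n]
    rfl

theorem pfaffian_map {S : Type*} [CommRing S] (σ : R →+* S) : ∀ (n : ℕ) (φ : Matrix _ _ R),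
    pfaffian n (φ.map σ) = σ (pfaffian n φ)
  | 0, φ => by simp [pfaffian]
  | 1, φ => by simp [pfaffian]
  | n + 2, φ => by
    simp only [pfaffian, map_sum, map_mul, map_pow, map_neg, map_one, submatrix_map,
      pfaffian_map σ n, map_apply]

/-- A vector in the kernel of an alternating matrix is killed by the Pfaffian. -/
theorem mul_pfaffian_eq_zero {n : ℕ} {φ : Matrix (Fin n) (Fin n) R} (hφ : IsAlternating φ)
    {w : Fin n → R} (hw : φ *ᵥ w = 0) (j : Fin n) : w j * pfaffian n φ = 0 := by
  have hb : (form φ).IsAlt := hφ.form_self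
  set E : Fin n → Fin n → R := fun i => Pi.single i 1 with hE
  have h1 : pfaffianMap hb n E = pfaffian n φ := by
    rw [← pfaffian_gram]
    congr 1
    ext a c
    exact form_single a c
  -- As in Cramer's rule, `w` replaces the `j`-th basis vector. The new Gram matrix has zero `j`-th
  -- row and column, so its Pfaffian also vanishes.
  have h2 : pfaffianMap hb n (Function.update E j w) = w j * pfaffian n φ := by
    have hsum : w = ∑ i, w i • E i := by
      ext k
      simp [hE, Finset.sum_apply, Pi.single_apply]
    conv_lhs => rw [hsum]
    rw [AlternatingMap.map_update_sum, Finset.sum_eq_single j]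
    · rw [AlternatingMap.map_update_smul, Function.update_eq_self, h1, smul_eq_mul]
    · intro i _ hi
      rw [AlternatingMap.map_update_smul, AlternatingMap.map_update_self _ _ hi.symm, smul_zero]
    · simp
  have hw1 : ∀ x, form φ x w = 0 := fun x => by rw [form_apply, hw, dotProduct_zero]
  have h3 : pfaffianMap hb n (Function.update E j w) =
      pfaffianMap hb n (Function.update E j 0) := by
    rw [← pfaffian_gram, ← pfaffian_gram]
    congr 1
    ext a c
    simp only [of_apply, Function.update_apply]
    split_ifs <;> simp [hw1, hφ.form_swap (hw1 _)]
  rw [← h2, h3, AlternatingMap.map_update_zero]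

/-- Were the determinant in a maximal ideal, a nonzero kernel vector over the residue field would be
killed by the Pfaffian, which is `1`; the identity `det = Pf²` is not needed. -/
theorem isUnit_det_of_pfaffian {n : ℕ} {φ : Matrix (Fin n) (Fin n) R} (hφ : IsAlternating φ)
    (hpf : pfaffian n φ = 1) : IsUnit φ.det := by
  by_contra h
  obtain ⟨𝔪, h𝔪, hdet⟩ := exists_max_ideal_of_mem_nonunits h
  let _ := Ideal.Quotient.field 𝔪
  set σ := Ideal.Quotient.mk 𝔪
  have h0 : (φ.map σ).det = 0 := by
    have := RingHom.map_det σ φ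
    rw [Ideal.Quotient.eq_zero_iff_mem.2 hdet] at this
    exact this.symm
  obtain ⟨w, hw0, hw⟩ := Matrix.exists_mulVec_eq_zero_iff.2 h0
  refine hw0 (funext fun j => ?_)
  have := mul_pfaffian_eq_zero (hφ.map σ) hw j
  rwa [pfaffian_map, hpf, map_one, mul_one] at this

end Pfaffian

/-! ### A second pair, nondegenerate at a given maximal ideal. -/

section ComplementaryPair

variable {m : ℕ} {R : Type*} [CommRing R] {φ : Matrix (Fin (m + 1)) (Fin (m + 1)) R}

theorem exists_form_notMem (hm : 2 ≤ m) (hφ : IsAlternating φ) (hdet : IsUnit φ.det) (𝔪 : Ideal R)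
    [h𝔪 : 𝔪.IsMaximal] :
    ∃ u ∈ perp φ (dualVec φ) (firstVec m R), ∃ v ∈ perp φ (dualVec φ) (firstVec m R),
      form φ u v ∉ 𝔪 := by
  by_contra! H
  let _ := Ideal.Quotient.field 𝔪
  set σ := Ideal.Quotient.mk 𝔪
  set e := dualVec φ
  set f := firstVec m R
  set E : Fin (m + 1) → R := fun i => form φ e (Pi.single i 1) with hE
  set F : Fin (m + 1) → R := fun i => form φ f (Pi.single i 1) with hF
  have hp := fun i : Fin (m + 1) =>
    exists_perp_add (form_dualVec_firstVec hdet) hφ (Pi.single i 1)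
  -- If the form vanishes modulo `𝔪` on the complement of `e, f`, projecting the basis vectors there
  -- gives `φ i j ≡ E i * F j - F i * E j`, of rank at most `2 < m + 1`.
  have key : φ.map σ = (Matrix.of fun i => ![σ (E i), -σ (F i)]) * Matrix.of ![σ ∘ F, σ ∘ E] := by
    ext i j
    have hpi := mem_perp.1 (hp i)
    have h := H _ (hp i) _ (hp j)
    rw [map_add, map_sub, map_smul, map_smul, hφ.form_swap hpi.1, hφ.form_swap hpi.2, smul_zero,
      smul_zero, sub_zero, add_zero] at h
    simp only [map_add, map_sub, map_smul, LinearMap.add_apply, LinearMap.sub_apply,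
      LinearMap.smul_apply, form_single, smul_eq_mul] at h
    have h' := Ideal.Quotient.eq_zero_iff_mem.2 h
    rw [map_add, map_sub, map_mul, map_mul] at h'
    simp only [map_apply, Matrix.mul_apply, Fin.sum_univ_two, of_apply, cons_val_zero,
      cons_val_one, Function.comp_apply, hE, hF]
    linear_combination h'
  have h1 : (φ.map σ).rank = m + 1 := by
    rw [rank_of_isUnit _ ((Matrix.isUnit_iff_isUnit_det _).2 (isUnit_det_map σ hdet)),
      Fintype.card_fin]
  have h2 := (rank_mul_le_left (Matrix.of fun i => ![σ (E i), -σ (F i)])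
    (Matrix.of ![σ ∘ F, σ ∘ E])).trans (rank_le_width _)
  rw [← key, h1] at h2
  omega

end ComplementaryPair

/-! ### Quillen's ideal and the one-variable theorem. -/

section LocalGlobal

open Polynomial

variable {m : ℕ} {R : Type*} [CommRing R] {φ : Matrix (Fin (m + 1)) (Fin (m + 1)) R}

theorem map_mem_ESp_map (hφ : IsAlternating φ) (hdet : IsUnit φ.det) {A A' : Type*} [CommRing A]
    [CommRing A'] (τ : A →+* A') (σ : R →+* A) (σ' : R →+* A') (h : τ.comp σ = σ')
    {g : GL (Fin (m + 1)) A} (hg : g ∈ ESp (φ.map σ)) :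
    GeneralLinearGroup.map τ g ∈ ESp (φ.map σ') := by
  subst h
  exact map_mem_ESp τ (hφ.map σ) (isUnit_det_map σ hdet) hg

theorem dilation_ESp {B B' : Type*} [CommRing B] [CommRing B'] {M : Submonoid B} {ρ : B →+* B'}
    (h : IsLoc M ρ) {ψ : Matrix (Fin (m + 1)) (Fin (m + 1)) B} (hψ : IsAlternating ψ)
    (hdet : IsUnit ψ.det) {u v : Fin (m + 1) → B} (hu : u ∈ perp ψ (dualVec ψ) (firstVec m B))
    (hv : v ∈ perp ψ (dualVec ψ) (firstVec m B)) (huv : form ψ u v ∈ M)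
    {θ : GL (Fin (m + 1)) B[X]} (h0 : GeneralLinearGroup.map (scale 0) θ = 1)
    (hθ : GeneralLinearGroup.map (mapRingHom ρ) θ ∈ ESp (ψ.map (C.comp ρ))) :
    ∃ t ∈ M, GeneralLinearGroup.map (scale t) θ ∈ ESp (ψ.map (C : B →+* B[X])) := by
  rw [ESp_eq_elem (hψ.map _) (isUnit_det_map _ hdet), ← comp_dualVec _ hdet,
    ← comp_firstVec (C.comp ρ)] at hθ
  rw [ESp_eq_elem (hψ.map _) (isUnit_det_map _ hdet), ← comp_dualVec _ hdet,
    ← comp_firstVec (C : B →+* B[X])]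
  exact h.dilation _ _ (form_dualVec_firstVec hdet) hu hv huv h0 hθ

/-- The substitution `X ↦ X + s Y`. -/
noncomputable def shift (s : R) : R[X] →+* R[X][X] :=
  eval₂RingHom (C.comp C) (C X + C (C s) * X)

theorem shift_C (s a : R) : shift s (C a) = C (C a) := by simp [shift]

theorem shift_X (s : R) : shift s X = C X + C (C s) * X := by simp [shift]

theorem scale_comp_shift (r s : R) : (scale (C r)).comp (shift s) = shift (r * s) := by
  refine ringHom_ext (fun a => ?_) ?_
  · simp [shift_C, scale_C]
  · simp only [RingHom.comp_apply, shift_X, map_add, map_mul, scale_C]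
    rw [scale_apply, X_comp]
    ring

/-- The substitution `X ↦ X + s Y` with `Y` fixed; it makes Quillen's set closed under addition. -/
theorem exists_comp_shift (s : R) : ∃ α : R[X][X] →+* R[X][X],
    (∀ s', α.comp (shift s') = shift (s + s')) ∧ α.comp (C.comp C) = C.comp C := by
  refine ⟨eval₂RingHom (shift s) X, fun s' => ?_, ?_⟩
  · refine ringHom_ext (fun a => ?_) ?_
    · simp [shift_C]
    · simp [shift_X, shift_C]
      ring
  · ext a
    simp [shift_C]

theorem mapRingHom_comp_shift {R' : Type*} [CommRing R'] (ρ : R →+* R') (s : R) :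
    (mapRingHom (mapRingHom ρ)).comp (shift s) = (shift (ρ s)).comp (mapRingHom ρ) := by
  refine ringHom_ext (fun a => ?_) ?_
  · simp [shift_C]
  · simp [shift_X]

theorem eval_comp_shift (s : R) :
    (eval₂RingHom (C.comp (evalRingHom 0)) X : R[X][X] →+* R[X]).comp (shift s) = scale s := by
  refine ringHom_ext (fun a => ?_) ?_
  · simp [shift_C, scale_C]
  · simp [shift_X, scale_apply]

theorem scale_one : scale (1 : R) = RingHom.id _ := by
  refine RingHom.ext fun p => ?_
  simp [scale_apply]

/-- The ideal of all `s` such that `θ(X + s Y) θ(X)⁻¹` is elementary. -/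
noncomputable def quillenIdeal (hφ : IsAlternating φ) (hdet : IsUnit φ.det)
    (θ : GL (Fin (m + 1)) R[X]) : Ideal R where
  carrier := {s | GeneralLinearGroup.map (shift s) θ * (GeneralLinearGroup.map (shift 0) θ)⁻¹ ∈
    ESp (φ.map (C.comp C : R →+* R[X][X]))}
  zero_mem' := by simp
  add_mem' := by
    intro s s' hs hs'
    rw [Set.mem_ofPred_eq] at hs hs' ⊢
    obtain ⟨α, hα, hα'⟩ := exists_comp_shift s
    have := map_mem_ESp_map hφ hdet α _ _ hα' hs'
    rw [map_mul, map_inv, gl_map_map, gl_map_map, hα, hα, add_zero] at this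
    simpa [mul_assoc] using mul_mem this hs
  smul_mem' := by
    intro r s hs
    rw [Set.mem_ofPred_eq] at hs ⊢
    have := map_mem_ESp_map hφ hdet (scale (C r)) _ (C.comp C) (by ext; simp [scale_C]) hs
    rwa [map_mul, map_inv, gl_map_map, gl_map_map, scale_comp_shift, scale_comp_shift,
      mul_zero] at this

theorem mem_quillenIdeal (hφ : IsAlternating φ) (hdet : IsUnit φ.det)
    (θ : GL (Fin (m + 1)) R[X]) (s : R) : s ∈ quillenIdeal hφ hdet θ ↔
      GeneralLinearGroup.map (shift s) θ * (GeneralLinearGroup.map (shift 0) θ)⁻¹ ∈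
        ESp (φ.map (C.comp C : R →+* R[X][X])) := Iff.rfl

/-- The local-global principle over the polynomial ring in one variable. -/
theorem mem_ESp_of_local (hm : 2 ≤ m) (hφ : IsAlternating φ) (hdet : IsUnit φ.det)
    {θ : GL (Fin (m + 1)) R[X]} (h0 : GeneralLinearGroup.map (scale 0) θ = 1)
    (hloc : ∀ (𝔪 : Ideal R) [𝔪.IsMaximal],
      GeneralLinearGroup.map (mapRingHom (algebraMap R (Localization.AtPrime 𝔪))) θ ∈
        ESp (φ.map (C.comp (algebraMap R (Localization.AtPrime 𝔪))))) :
    θ ∈ ESp (φ.map (C : R →+* R[X])) := by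
  have hone : (1 : R) ∈ quillenIdeal hφ hdet θ := by
    rw [← Ideal.eq_top_iff_one]
    by_contra hne
    obtain ⟨𝔪, h𝔪, hle⟩ := Ideal.exists_le_maximal _ hne
    obtain ⟨u, hu, v, hv, huv⟩ := exists_form_notMem hm hφ hdet 𝔪
    set ρ := algebraMap R (Localization.AtPrime 𝔪) with hρ
    -- Dilation is applied in the variable `Y` over the base ring `R[X]`, to `θ(X + Y) θ(X)⁻¹`; the
    -- resulting factor is a constant `s ∉ 𝔪` lying in the ideal.
    have hL : IsLoc (𝔪.primeCompl.map (C : R →+* R[X])) (mapRingHom ρ) :=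
      (isLoc_algebraMap 𝔪.primeCompl).polynomial
    have hu' := map_mem_perp (σ := (C : R →+* R[X])) rfl hu
    have hv' := map_mem_perp (σ := (C : R →+* R[X])) rfl hv
    rw [comp_dualVec _ hdet, comp_firstVec] at hu' hv'
    obtain ⟨_, ⟨s, hs, rfl⟩, hs'⟩ := dilation_ESp hL (hφ.map C) (isUnit_det_map C hdet) hu' hv'
      (by rw [← map_form rfl]; exact ⟨_, huv, rfl⟩)
      (θ := GeneralLinearGroup.map (shift 1) θ * (GeneralLinearGroup.map (shift 0) θ)⁻¹)
      (by
        have h := scale_comp_shift (0 : R)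
        rw [C_0] at h
        rw [map_mul, map_inv, gl_map_map, gl_map_map, h, h, zero_mul, zero_mul, mul_inv_cancel])
      (by
        have e1 : (φ.map (C : R →+* R[X])).map (C.comp (mapRingHom ρ)) =
            φ.map ((C.comp C).comp ρ) := by
          ext1 i j
          simp
        rw [map_mul, map_inv, gl_map_map, gl_map_map, mapRingHom_comp_shift,
          mapRingHom_comp_shift, ← gl_map_map, ← gl_map_map, e1]
        have key := fun a => map_mem_ESp_map hφ hdet (shift a) _ ((C.comp C).comp ρ)
          (RingHom.ext fun b => by simp [shift_C, hρ]) (hloc 𝔪)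
        exact mul_mem (key _) (inv_mem (key _)))
    refine hs (hle ?_)
    rw [mem_quillenIdeal]
    rw [map_mul, map_inv, gl_map_map, gl_map_map, scale_comp_shift,
      scale_comp_shift, mul_one, mul_zero, Matrix.map_map] at hs'
    exact hs'
  rw [mem_quillenIdeal] at hone
  have := map_mem_ESp_map hφ hdet (eval₂RingHom (C.comp (evalRingHom 0)) X : R[X][X] →+* R[X]) _
    C (by ext; simp) hone
  rwa [map_mul, map_inv, gl_map_map, gl_map_map, eval_comp_shift, eval_comp_shift, h0, inv_one,
    mul_one, scale_one, GeneralLinearGroup.map_id] at this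

end LocalGlobal

/-! ### Reduction from several variables to one. -/

section Homotopy

variable {R : Type*} [CommRing R] {t : ℕ}

/-- The homotopy `Xᵢ ↦ Xᵢ T`. -/
noncomputable def homotopy (R : Type*) [CommRing R] (t : ℕ) :
    MvPolynomial (Fin t) R →+* Polynomial (MvPolynomial (Fin t) R) :=
  MvPolynomial.eval₂Hom (Polynomial.C.comp MvPolynomial.C)
    fun i => Polynomial.C (MvPolynomial.X i) * Polynomial.X

theorem scale_zero_comp_homotopy : (scale 0).comp (homotopy R t) =
    (Polynomial.C.comp MvPolynomial.C).comp (MvPolynomial.eval (0 : Fin t → R)) := by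
  refine MvPolynomial.ringHom_ext (fun a => ?_) fun i => ?_
  · simp [homotopy, scale_C]
  · simp [homotopy, scale_zero_apply]

theorem eval_one_comp_homotopy :
    (Polynomial.evalRingHom 1).comp (homotopy R t) = RingHom.id _ := by
  refine MvPolynomial.ringHom_ext (fun a => ?_) fun i => ?_
  · simp [homotopy]
  · simp [homotopy]

/-- The contraction of `𝔫` to `R` is prime but need not be maximal. Any maximal `𝔪` above it works:
elements outside `𝔪` remain outside `𝔫`, so localization at `𝔪` maps to localization at `𝔫`. -/
theorem exists_homotopy_factor (𝔫 : Ideal (MvPolynomial (Fin t) R)) [𝔫.IsMaximal] :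
    ∃ (𝔪 : Ideal R) (_ : 𝔪.IsMaximal) (τ : MvPolynomial (Fin t) (Localization.AtPrime 𝔪) →+*
      Polynomial (Localization.AtPrime 𝔫)),
      τ.comp (MvPolynomial.map (algebraMap R (Localization.AtPrime 𝔪))) =
        (Polynomial.mapRingHom (algebraMap _ (Localization.AtPrime 𝔫))).comp (homotopy R t) := by
  have hp : (𝔫.comap MvPolynomial.C).IsPrime := Ideal.comap_isPrime _ _
  obtain ⟨𝔪, h𝔪, hle⟩ := Ideal.exists_le_maximal _ hp.ne_top
  set ρ := algebraMap (MvPolynomial (Fin t) R) (Localization.AtPrime 𝔫) with hρ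
  have hunit : ∀ y : 𝔪.primeCompl, IsUnit ((ρ.comp MvPolynomial.C) y) := fun y =>
    IsLocalization.map_units (M := 𝔫.primeCompl) (Localization.AtPrime 𝔫)
      ⟨MvPolynomial.C (y : R), fun h => y.2 (hle h)⟩
  refine ⟨𝔪, h𝔪, MvPolynomial.eval₂Hom (Polynomial.C.comp (IsLocalization.lift hunit))
    (fun i => Polynomial.C (ρ (MvPolynomial.X i)) * Polynomial.X), ?_⟩
  refine MvPolynomial.ringHom_ext (fun a => ?_) fun i => ?_
  · simp [homotopy]
  · simp [homotopy]

end Homotopy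

end AltForm

theorem lemma4p2 {R : Type*} [CommRing R] (n m t : ℕ) (hn : 2 ≤ n) (hm : m + 1 = 2 * n)
    (φ : Matrix (Fin (m + 1)) (Fin (m + 1)) R)
    (hφ : AltForm.IsAlternating φ) (hpf : AltForm.pfaffian (m + 1) φ = 1)
    (θ : GL (Fin (m + 1)) (MvPolynomial (Fin t) R))
    (hθ : θ ∈ AltForm.Sp (φ.map (algebraMap R (MvPolynomial (Fin t) R))))
    (hθ0 : Matrix.GeneralLinearGroup.map (MvPolynomial.eval (0 : Fin t → R)) θ = 1)
    (hloc : ∀ (𝔪 : Ideal R) [𝔪.IsMaximal],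
      Matrix.GeneralLinearGroup.map
          (MvPolynomial.map (σ := Fin t) (algebraMap R (Localization.AtPrime 𝔪))) θ ∈
        AltForm.ESp
          (φ.map (algebraMap R (MvPolynomial (Fin t) (Localization.AtPrime 𝔪))))) :
    θ ∈ AltForm.ESp (φ.map (algebraMap R (MvPolynomial (Fin t) R))) := by
  have hdet := AltForm.isUnit_det_of_pfaffian hφ hpf
  have hS := hφ.map (algebraMap R (MvPolynomial (Fin t) R))
  have hSdet := AltForm.isUnit_det_map (algebraMap R (MvPolynomial (Fin t) R)) hdet
  -- The base ring is now `R[X₁, …, X_t]` and the variable is `T`; evaluation at `T = 1` recovers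
  -- `θ`.
  have key := AltForm.mem_ESp_of_local (by omega) hS hSdet
    (θ := GeneralLinearGroup.map (AltForm.homotopy R t) θ)
    (by rw [AltForm.gl_map_map, AltForm.scale_zero_comp_homotopy, ← AltForm.gl_map_map, hθ0,
      map_one]) fun 𝔫 h𝔫 => by
      obtain ⟨𝔪, h𝔪, τ, hτ⟩ := AltForm.exists_homotopy_factor 𝔫
      rw [AltForm.gl_map_map, ← hτ, ← AltForm.gl_map_map]
      have := AltForm.map_mem_ESp_map hφ hdet
        (A := MvPolynomial (Fin t) (Localization.AtPrime 𝔪))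
        (A' := Polynomial (Localization.AtPrime 𝔫)) τ _ _ rfl (hloc 𝔪)
      convert this using 2
      ext1 i j
      have h := RingHom.congr_fun hτ (MvPolynomial.C (φ i j))
      simp only [RingHom.comp_apply, MvPolynomial.map_C] at h
      change Polynomial.C (algebraMap _ _ (MvPolynomial.C (φ i j))) =
        τ (MvPolynomial.C (algebraMap _ _ (φ i j)))
      rw [h]
      simp [AltForm.homotopy]
  have := AltForm.map_mem_ESp_map hS hSdet (Polynomial.evalRingHom 1) _ (RingHom.id _)
    (RingHom.ext fun a => by simp) key
  rwa [AltForm.gl_map_map, AltForm.eval_one_comp_homotopy, GeneralLinearGroup.map_id,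
    Matrix.map_map] at this
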